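/- Work on a word RAM with $w$-bit words (unit-cost arithmetic, bitwise and memory operations, optionally independent uniformly random words), where $w \ge c\log_2(n+\sigma+1)$ for a constant $c$ that may depend on the algorithm, $n$ is the total length of the input strings (before run-length encoding) and $\sigma$ is the alphabet size. Strings are over $\{0,\dots,\sigma-1\}$; space is the number of words of memory used, not counting the read-only input. To sort a set $\mathcal{P}=\{P_1,\dots,P_k\}$ of $k\ge 1$ distinct nonempty strings means to output the indices $1,\dots,k$ in increasing lexicographic order of the strings. The run-length encoding (RLE) of a string replaces each maximal run of $x$ copies of a character $\alpha$ by the pair $(\alpha,x)$. Lemma. Suppose that some algorithm sorts every set of $k$ strings of total length $m$ from an alphabet of size $\sigma$ in time $t(k,m,\sigma)$ and space $s(k,m,\sigma)$. Then there is an algorithm that, given the RLE representation, with $\overline{m}$ runs in total, of any set $\mathcal{P}$ of $k$ strings of total length $m$ from an alphabet of size $\sigma$, sorts $\mathcal{P}$ in $O(t(k,\overline{m},\sigma\cdot m)+\overline{m})$ time and $O(s(k,\overline{m},\sigma\cdot m)+\overline{m})$ space, with absolute constants in the $O$-bounds. This holds both for deterministic algorithms with worst-case time and for randomised algorithms with expected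 time (whose output is correct, and whose space bound holds, with probability one). -/

import Mathlib

open scoped NNReal ENNReal

/-! ### The word RAM

Memory consists of finitely many registers and finitely many zero-initialised arrays of `w`-bit
words (a program mentions only finitely many names), together with read-only input arrays and a
supply of independent uniformly random words.  Control flow is structured. -/

namespace WordRAM

/-- Binary operations on words; the comparisons return the word `1` or `0`. -/
inductive BinOp where
  | add | sub | mul | div | mod | and | or | xor | shl | shr | lt | eq

def BinOp.eval {w : ℕ} : BinOp → BitVec w → BitVec w → BitVec w
  | .add, a, b => a + b
  | .sub, a, b => a - b
  | .mul, a, b => a * b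
  | .div, a, b => a / b
  | .mod, a, b => a % b
  | .and, a, b => a &&& b
  | .or, a, b => a ||| b
  | .xor, a, b => a ^^^ b
  | .shl, a, b => a <<< b.toNat
  | .shr, a, b => a >>> b.toNat
  | .lt, a, b => if a.toNat < b.toNat then BitVec.ofNat w 1 else BitVec.ofNat w 0
  | .eq, a, b => if a = b then BitVec.ofNat w 1 else BitVec.ofNat w 0

/-- Unit-cost instructions. The letters `r`, `x`, `y`, `i` are names of registers, `a` is the name
of an array (of an input array in `input`). -/
inductive Instr where
  /-- `r := c` -/
  | const (r c : ℕ)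
  /-- `r := x ∘ y` -/
  | op (o : BinOp) (r x y : ℕ)
  /-- `r := input_a[i]` -/
  | input (r a i : ℕ)
  /-- `r := a[i]` -/
  | load (r a i : ℕ)
  /-- `a[i] := x` -/
  | store (a i x : ℕ)
  /-- `r := ` a fresh uniformly random word -/
  | rand (r : ℕ)

/-- Programs. A program is fixed once and for all; it does not depend on the word length. -/
inductive Prog where
  | skip
  | instr (I : Instr)
  | seq (P Q : Prog)
  /-- run `P` if register `r` is nonzero, otherwise `Q` -/
  | ite (r : ℕ) (P Q : Prog)
  /-- run `P` as long as register `r` is nonzero -/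
  | loop (r : ℕ) (P : Prog)

/-- Machine states for word length `w`. The last three fields only keep accounts. -/
structure State (w : ℕ) where
  /-- the registers -/
  reg : ℕ → BitVec w
  /-- the writable arrays -/
  mem : ℕ → BitVec w → BitVec w
  /-- `ext a` is the length of the shortest initial segment of array `a` that contains all its
  cells accessed (read or written) so far -/
  ext : ℕ →₀ ℕ
  /-- number of random words used so far -/
  coins : ℕ
  /-- number of steps made so far -/
  steps : ℕ

namespace State

variable {w : ℕ}

def init (w : ℕ) : State w := ⟨fun _ => 0, fun _ _ => 0, 0, 0, 0⟩

def tick (s : State w) : State w := { s with steps := s.steps + 1 }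

def setReg (s : State w) (r : ℕ) (v : BitVec w) : State w :=
  { s with reg := Function.update s.reg r v }

def setMem (s : State w) (a : ℕ) (i v : BitVec w) : State w :=
  { s with mem := Function.update s.mem a (Function.update (s.mem a) i v) }

noncomputable def touch (s : State w) (a : ℕ) (i : BitVec w) : State w :=
  { s with ext := s.ext.update a (max (s.ext a) (i.toNat + 1)) }

/-- Number of words of writable memory used so far (the input arrays are not counted). -/
noncomputable def space (s : State w) : ℕ := s.ext.sum fun _ n => n

end State

/-- The effect of one instruction, for the input arrays `inp` and the random words `ω`. -/
noncomputable def Instr.exec {w : ℕ} (inp : ℕ → ℕ → BitVec w) (ω : ℕ → Fin (2 ^ w))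
    (s : State w) : Instr → State w
  | .const r c => (s.setReg r (BitVec.ofNat w c)).tick
  | .op o r x y => (s.setReg r (o.eval (s.reg x) (s.reg y))).tick
  | .input r a i => (s.setReg r (inp a (s.reg i).toNat)).tick
  | .load r a i => ((s.setReg r (s.mem a (s.reg i))).touch a (s.reg i)).tick
  | .store a i x => ((s.setMem a (s.reg i) (s.reg x)).touch a (s.reg i)).tick
  | .rand r => { (s.setReg r (BitVec.ofFin (ω s.coins))).tick with coins := s.coins + 1 }

/-- `Exec inp ω P s s'`: the program `P`, started in state `s`, halts in state `s'`.
Every instruction and every test of a register costs one step. -/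
inductive Exec {w : ℕ} (inp : ℕ → ℕ → BitVec w) (ω : ℕ → Fin (2 ^ w)) :
    Prog → State w → State w → Prop
  | skip (s : State w) : Exec inp ω .skip s s
  | instr (I : Instr) (s : State w) : Exec inp ω (.instr I) s (I.exec inp ω s)
  | seq {P Q : Prog} {s s' s'' : State w} :
      Exec inp ω P s s' → Exec inp ω Q s' s'' → Exec inp ω (.seq P Q) s s''
  | ite_true {r : ℕ} {P Q : Prog} {s s' : State w} :
      s.reg r ≠ 0 → Exec inp ω P s.tick s' → Exec inp ω (.ite r P Q) s s'
  | ite_false {r : ℕ} {P Q : Prog} {s s' : State w} :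
      s.reg r = 0 → Exec inp ω Q s.tick s' → Exec inp ω (.ite r P Q) s s'
  | loop_true {r : ℕ} {P : Prog} {s s' s'' : State w} :
      s.reg r ≠ 0 → Exec inp ω P s.tick s' → Exec inp ω (.loop r P) s' s'' →
      Exec inp ω (.loop r P) s s''
  | loop_false {r : ℕ} {P : Prog} {s : State w} :
      s.reg r = 0 → Exec inp ω (.loop r P) s s.tick

/-- The program contains no random instruction. -/
def Prog.RandFree : Prog → Prop
  | .skip => True
  | .instr (.rand _) => False
  | .instr _ => True
  | .seq P Q => P.RandFree ∧ Q.RandFree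
  | .ite _ P Q => P.RandFree ∧ Q.RandFree
  | .loop _ P => P.RandFree

/-- The law of a sequence of independent uniformly random `w`-bit words. -/
noncomputable def coinMeasure (w : ℕ) : MeasureTheory.Measure (ℕ → Fin (2 ^ w)) :=
  MeasureTheory.Measure.infinitePi fun _ => (PMF.uniformOfFintype (Fin (2 ^ w))).toMeasure

/-- Number of steps of `P` on the input `inp` with random words `ω`; `∞` if `P` does not halt. -/
noncomputable def Prog.runTime {w : ℕ} (P : Prog) (inp : ℕ → ℕ → BitVec w)
    (ω : ℕ → Fin (2 ^ w)) : ℝ≥0∞ :=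
  ⨅ (s : State w) (_ : Exec inp ω P (State.init w) s), (s.steps : ℝ≥0∞)

/-- Deterministic algorithms with worst-case time, or randomised (Las Vegas) algorithms with
expected time. -/
inductive Mode where
  | deterministic
  | expected

/-- On the input `inp`, the program `P` halts in a state satisfying `good`, within time `T` and
space `S`. In the mode `expected`, halting, correctness and the space bound hold with probability
one, and `T` bounds the expected time. -/
def Prog.Achieves {w : ℕ} (P : Prog) (inp : ℕ → ℕ → BitVec w) (good : State w → Prop)
    (T S : ℝ≥0) : Mode → Prop
  | .deterministic => P.RandFree ∧ ∀ ω, ∃ s : State w, Exec inp ω P (State.init w) s ∧ good s ∧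
      (s.steps : ℝ≥0) ≤ T ∧ (s.space : ℝ≥0) ≤ S
  | .expected =>
      (∀ᵐ ω ∂coinMeasure w, ∃ s : State w, Exec inp ω P (State.init w) s ∧ good s ∧
        (s.space : ℝ≥0) ≤ S) ∧
      ∫⁻ ω, P.runTime inp ω ∂coinMeasure w ≤ (T : ℝ≥0∞)

/-- Input arrays given by lists of numbers (padded with zeros). -/
def inputOf (w : ℕ) (arrs : List (List ℕ)) (a i : ℕ) : BitVec w :=
  BitVec.ofNat w ((arrs.getD a []).getD i 0)

end WordRAM

/-! ### Sorting strings, plain and run-length encoded -/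

namespace StringSorting

open WordRAM

/-- Run-length encoding: every maximal run of `x` copies of `c` becomes the pair `(c, x)`. -/
def rle : List ℕ → List (ℕ × ℕ)
  | [] => []
  | c :: l =>
    match rle l with
    | [] => [(c, 1)]
    | (d, x) :: R => if c = d then (d, x + 1) :: R else (c, 1) :: (d, x) :: R

/-- The sum of the lengths. -/
def totalLength {α : Type} {k : ℕ} (P : Fin k → List α) : ℕ := ∑ i, (P i).length

/-- The total number of runs. -/
def totalRuns {k : ℕ} (P : Fin k → List ℕ) : ℕ := totalLength fun i => rle (P i)

/-- The `k + 1` offsets of the strings in their concatenation (the last one is its length). -/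
def offsets {α : Type} {k : ℕ} (P : Fin k → List α) : List ℕ :=
  List.ofFn fun i : Fin (k + 1) => ((List.ofFn P).take i).flatten.length

/-- `P` is a set of `k ≥ 1` (distinct, nonempty) strings over the alphabet `{0, …, σ - 1}`. -/
structure IsStringSet {k : ℕ} (σ : ℕ) (P : Fin k → List ℕ) : Prop where
  pos : 0 < k
  injective : Function.Injective P
  ne_nil : ∀ i, P i ≠ []
  lt : ∀ i, ∀ c ∈ P i, c < σ

/-- Plain input: the numbers `k, m, σ`; the offsets; the concatenation of the strings. -/
def plainInput (w : ℕ) {k : ℕ} (σ : ℕ) (P : Fin k → List ℕ) : ℕ → ℕ → BitVec w :=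
  inputOf w [[k, totalLength P, σ], offsets P, (List.ofFn P).flatten]

/-- Run-length encoded input: the numbers `k, m̄, σ`; the offsets (counted in runs); the
characters of all runs; the lengths of all runs. -/
def rleInput (w : ℕ) {k : ℕ} (σ : ℕ) (P : Fin k → List ℕ) : ℕ → ℕ → BitVec w :=
  inputOf w [[k, totalRuns P, σ], offsets fun i => rle (P i),
    (List.ofFn fun i => rle (P i)).flatten.map Prod.fst,
    (List.ofFn fun i => rle (P i)).flatten.map Prod.snd]

/-- Array `0` lists the indices of the strings in increasing lexicographic order. -/
def SortedOutput {k : ℕ} (P : Fin k → List ℕ) {w : ℕ} (s : State w) : Prop :=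
  ∃ π : Equiv.Perm (Fin k), StrictMono (fun j => P (π j)) ∧
    ∀ j : Fin k, (s.mem 0 (BitVec.ofNat w j)).toNat = π j

/-- `A` sorts every set of `k` strings of total length `m` over an alphabet of size `σ` in time
`t k m σ` and space `s k m σ`, for words of logarithmic length. -/
def SortsStrings (μ : Mode) (A : Prog) (t s : ℕ → ℕ → ℕ → ℝ≥0) : Prop :=
  ∃ c : ℕ, ∀ (w k σ : ℕ) (P : Fin k → List ℕ), IsStringSet σ P →
    c * Nat.clog 2 (totalLength P + σ + 1) ≤ w →
    A.Achieves (plainInput w σ P) (SortedOutput P)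
      (t k (totalLength P) σ) (s k (totalLength P) σ) μ

/-- `B`, given only the run-length encodings, sorts every set of `k` strings of total length `m`
with `r` runs over an alphabet of size `σ` in time `t k m r σ` and space `s k m r σ`, for words of
logarithmic length. -/
def SortsRLEStrings (μ : Mode) (B : Prog) (t s : ℕ → ℕ → ℕ → ℕ → ℝ≥0) : Prop :=
  ∃ c : ℕ, ∀ (w k σ : ℕ) (P : Fin k → List ℕ), IsStringSet σ P →
    c * Nat.clog 2 (totalLength P + σ + 1) ≤ w →
    B.Achieves (rleInput w σ P) (SortedOutput P)
      (t k (totalLength P) (totalRuns P) σ) (s k (totalLength P) (totalRuns P) σ) μ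

end StringSorting

/-!
Sorting run-length encoded strings reduces to sorting strings with one letter per run. Let `M` be
the total length of the strings. A run of `x` copies of `c` becomes the letter `c * M + (x - 1)` if
the string then ends or continues with a smaller character, and `c * M + (M - x)` if it continues
with a larger one. A longer run makes a string larger in the former case and smaller in the latter,
and every run of the latter kind has to beat every run of the former kind. It does, although both
kinds share the `M` letters with high digit `c`, because two runs in different strings have lengths
`x + y ≤ M`, whence `x - 1 < M - y`. So the letters fit into an alphabet of size `σ * M`, and the
replacement preserves the lexicographic order (`StringSorting.letters_lt_letters`).

On the word RAM, the new text is computed in time `O(r)` for `r` runs and stored in one new array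
(`WordRAM.exec_prepare`): a first loop adds up the run lengths, a second one goes through the runs
backwards, with a pointer into the offsets that tells which runs are the last of their strings.
Then the given program runs with its reads from the input replaced by reads from the prepared data
(`WordRAM.Exec.simulate`). The simulation takes at most three steps for one and uses the same random
words, so bounds carry over pointwise in the random words, for both modes
(`WordRAM.Prog.Achieves.transfer`).
-/

/-! ### Replacing runs by letters -/

namespace StringSorting

/-- The letter that replaces a run of `x` copies of `c` followed by the character `d`, where `d = 0`
if the string ends there. Its high digit in base `M` is `c`. The low digit grows with `x` if the
string continues with a smaller character or ends, and falls with `x` if it continues with a larger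
one. -/
def runLetter (M c x d : ℕ) : ℕ := c * M + if c < d then M - x else x - 1

/-- The first character of a run-length encoded string, `0` if there is none. -/
def firstChar (R : List (ℕ × ℕ)) : ℕ := (R.map Prod.fst).headD 0

/-- The string obtained by replacing every run by one letter. -/
def letters (M : ℕ) : List (ℕ × ℕ) → List ℕ
  | [] => []
  | (c, x) :: R => runLetter M c x (firstChar R) :: letters M R

/-- The string with the given runs. -/
def decode (R : List (ℕ × ℕ)) : List ℕ := R.flatMap fun p => List.replicate p.2 p.1

/-- All runs are nonempty and adjacent runs have different characters. -/
def IsReduced : List (ℕ × ℕ) → Prop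
  | [] => True
  | (c, x) :: R => 0 < x ∧ (R ≠ [] → c ≠ firstChar R) ∧ IsReduced R

@[simp] theorem decode_nil : decode [] = [] := rfl

@[simp] theorem decode_cons (p : ℕ × ℕ) (R : List (ℕ × ℕ)) :
    decode (p :: R) = List.replicate p.2 p.1 ++ decode R := by
  simp [decode]

@[simp] theorem firstChar_nil : firstChar [] = 0 := rfl

@[simp] theorem firstChar_cons (p : ℕ × ℕ) (R : List (ℕ × ℕ)) : firstChar (p :: R) = p.1 := rfl

theorem decode_rle (l : List ℕ) : decode (rle l) = l := by
  induction l with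
  | nil => rfl
  | cons c l ih =>
    rw [rle]
    split
    · next h => rw [h] at ih; simp [← ih]
    · next d x R h =>
      rw [h] at ih
      split_ifs with hcd
      · subst hcd
        rw [← ih]
        simp [List.replicate_succ]
      · rw [← ih]
        simp

theorem isReduced_rle (l : List ℕ) : IsReduced (rle l) := by
  induction l with
  | nil => trivial
  | cons c l ih =>
    rw [rle]
    split
    · simp [IsReduced]
    · next d x R h =>
      rw [h] at ih
      split_ifs with hcd
      · exact ⟨Nat.succ_pos x, ih.2⟩
      · exact ⟨Nat.one_pos, fun _ => hcd, ih⟩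

theorem rle_ne_nil {l : List ℕ} (h : l ≠ []) : rle l ≠ [] := by
  intro h'
  apply h
  rw [← decode_rle l, h', decode_nil]

theorem length_letters (M : ℕ) (R : List (ℕ × ℕ)) : (letters M R).length = R.length := by
  induction R with
  | nil => rfl
  | cons p R ih => simp [letters, ih]

theorem sum_snd_eq_length_decode (R : List (ℕ × ℕ)) :
    (R.map Prod.snd).sum = (decode R).length := by
  induction R with
  | nil => rfl
  | cons p R ih => simp [ih]

theorem IsReduced.length_le_length_decode {R : List (ℕ × ℕ)} (h : IsReduced R) :
    R.length ≤ (decode R).length := by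
  induction R with
  | nil => simp
  | cons p R ih =>
    have h1 := h.1
    have h2 := ih h.2.2
    simp only [List.length_cons, decode_cons, List.length_append, List.length_replicate]
    omega

theorem IsReduced.pos_of_mem {R : List (ℕ × ℕ)} (h : IsReduced R) {p : ℕ × ℕ} (hp : p ∈ R) :
    0 < p.2 := by
  induction R with
  | nil => simp at hp
  | cons q R ih =>
    rcases List.mem_cons.1 hp with rfl | hp
    · exact h.1
    · exact ih h.2.2 hp

theorem le_length_decode_of_mem {R : List (ℕ × ℕ)} {p : ℕ × ℕ} (hp : p ∈ R) :
    p.2 ≤ (decode R).length := by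
  rw [← sum_snd_eq_length_decode]
  exact List.single_le_sum (fun _ _ => Nat.zero_le _) _ (List.mem_map_of_mem hp)

theorem IsReduced.headD_decode {R : List (ℕ × ℕ)} (h : IsReduced R) :
    (decode R).headD 0 = firstChar R := by
  cases R with
  | nil => rfl
  | cons p R =>
    obtain ⟨y, hy⟩ := Nat.exists_eq_add_one_of_ne_zero h.1.ne'
    simp [decode_cons, hy, List.replicate_succ]

theorem headD_le_headD_of_lt {l l' : List ℕ} (h : l < l') : l.headD 0 ≤ l'.headD 0 := by
  cases l with
  | nil => simp
  | cons a l =>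
    cases l' with
    | nil => simp at h
    | cons b l' =>
      rcases List.cons_lt_cons_iff.1 h with h | h
      · exact h.le
      · exact h.1.le

theorem append_lt_append_left_iff (l : List ℕ) {l₁ l₂ : List ℕ} :
    l ++ l₁ < l ++ l₂ ↔ l₁ < l₂ := by
  induction l with
  | nil => simp
  | cons a l ih => simpa using ih

theorem runLetter_mem {M c x : ℕ} (d : ℕ) (hx : 0 < x) (hxM : x ≤ M) :
    c * M ≤ runLetter M c x d ∧ runLetter M c x d < (c + 1) * M := by
  rw [runLetter, add_mul, one_mul]
  split_ifs <;> omega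

/-- Replacing runs by letters preserves the lexicographic order. Two strings first differ in runs
of lengths `x` and `y` with `x + y ≤ M`, so the low digits `x - 1` and `M - y` of equal characters
do not interleave. -/
theorem letters_lt_letters {M : ℕ} {U V : List (ℕ × ℕ)} (hU : IsReduced U) (hV : IsReduced V)
    (hM : (decode U).length + (decode V).length ≤ M) (h : decode U < decode V) :
    letters M U < letters M V := by
  induction U generalizing V with
  | nil =>
    cases V with
    | nil => simp at h
    | cons q V => simp [letters]
  | cons p U ih =>
    obtain ⟨c, x⟩ := p
    cases V with
    | nil => simp at h
    | cons q V =>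
      obtain ⟨d, y⟩ := q
      obtain ⟨hx, hcU, hU'⟩ := hU
      obtain ⟨hy, hdV, hV'⟩ := hV
      simp only [decode_cons, List.length_append, List.length_replicate] at hM h
      have hle : c ≤ d := by
        have := headD_le_headD_of_lt h
        obtain ⟨x', rfl⟩ := Nat.exists_eq_add_one_of_ne_zero hx.ne'
        obtain ⟨y', rfl⟩ := Nat.exists_eq_add_one_of_ne_zero hy.ne'
        simpa [List.replicate_succ] using this
      simp only [letters, List.cons_lt_cons_iff]
      rcases hle.lt_or_eq with hcd | rfl
      · left
        calc runLetter M c x (firstChar U) < (c + 1) * M :=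
              (runLetter_mem _ hx (by omega)).2
          _ ≤ d * M := Nat.mul_le_mul_right _ hcd
          _ ≤ _ := (runLetter_mem _ hy (by omega)).1
      rcases lt_trichotomy x y with hxy | rfl | hxy
      · obtain ⟨z, rfl⟩ := Nat.exists_eq_add_of_lt hxy
        rw [add_assoc, List.replicate_add, List.append_assoc, append_lt_append_left_iff] at h
        have h1 := headD_le_headD_of_lt h
        rw [hU'.headD_decode] at h1
        simp only [List.replicate_succ, List.cons_append, List.headD_cons] at h1
        left
        simp only [runLetter]
        split_ifs <;> omega
      · rw [append_lt_append_left_iff] at h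
        have h1 := headD_le_headD_of_lt h
        rw [hU'.headD_decode, hV'.headD_decode] at h1
        have h2 := ih hU' hV' (by omega) h
        simp only [h2, and_true]
        simp only [runLetter]
        split_ifs <;> omega
      · obtain ⟨z, rfl⟩ := Nat.exists_eq_add_of_lt hxy
        rw [add_assoc, List.replicate_add, List.append_assoc, append_lt_append_left_iff] at h
        have h1 := headD_le_headD_of_lt h
        rw [hV'.headD_decode] at h1
        simp only [List.replicate_succ, List.cons_append, List.headD_cons] at h1
        have hne : V ≠ [] := by
          rintro rfl
          simp at h
        have h2 := hdV hne
        left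
        simp only [runLetter]
        split_ifs <;> omega

theorem getD_letters (M : ℕ) (R : List (ℕ × ℕ)) {j : ℕ} (hj : j < R.length) :
    (letters M R).getD j 0 = runLetter M ((R.map Prod.fst).getD j 0) ((R.map Prod.snd).getD j 0)
      ((R.map Prod.fst).getD (j + 1) 0) := by
  induction R generalizing j with
  | nil => simp at hj
  | cons p R ih =>
    cases j with
    | zero => cases R <;> simp [letters]
    | succ j =>
      have := ih (j := j) (by simpa using hj)
      simpa [letters] using this

open Classical in
/-- The letter at position `j` of the concatenation, read off from the concatenated runs and the
offsets of the strings. -/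
theorem getD_flatten_letters (M : ℕ) (L : List (List (ℕ × ℕ))) (hL : ∀ R ∈ L, R ≠ [])
    {j : ℕ} (hj : j < L.flatten.length) :
    (L.map (letters M)).flatten.getD j 0 =
      runLetter M ((L.flatten.map Prod.fst).getD j 0) ((L.flatten.map Prod.snd).getD j 0)
        (if ∃ q ≤ L.length, (L.take q).flatten.length = j + 1 then 0
          else (L.flatten.map Prod.fst).getD (j + 1) 0) := by
  induction L generalizing j with
  | nil => simp at hj
  | cons R L ih =>
    have hL' : ∀ R ∈ L, R ≠ [] := fun S hS => hL S (List.mem_cons_of_mem _ hS)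
    have hlen := length_letters M R
    simp only [List.map_cons, List.flatten_cons, List.map_append]
    rcases lt_or_ge j R.length with h | h
    · rw [List.getD_append _ _ _ _ (by omega), List.getD_append _ _ _ _ (by simpa using h),
        List.getD_append _ _ _ _ (by simpa using h), getD_letters M R h]
      congr 1
      rcases Nat.lt_or_ge (j + 1) R.length with h' | h'
      · rw [if_neg, List.getD_append _ _ _ _ (by simpa using h')]
        rintro ⟨q, -, hq⟩
        cases q with
        | zero => simp at hq
        | succ q =>
          simp only [List.take_succ_cons, List.flatten_cons, List.length_append] at hq
          omega
      · rw [if_pos ⟨1, by simp, by simpa using by omega⟩, List.getD_eq_default _ _ (by simpa)]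
    · rw [List.getD_append_right _ _ _ _ (by omega), List.getD_append_right _ _ _ _ (by simpa),
        List.getD_append_right _ _ _ _ (by simpa), hlen]
      simp only [List.length_map]
      rw [List.flatten_cons, List.length_append] at hj
      rw [ih hL' (j := j - R.length) (by omega)]
      congr 1
      have h1 : (∃ q ≤ (R :: L).length, ((R :: L).take q).flatten.length = j + 1) ↔
          ∃ q ≤ L.length, (L.take q).flatten.length = j - R.length + 1 := by
        constructor
        · rintro ⟨q, hq, hq'⟩
          cases q with
          | zero => simp at hq'
          | succ q =>
            simp only [List.take_succ_cons, List.flatten_cons, List.length_append] at hq'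
            exact ⟨q, by simpa using hq, by omega⟩
        · rintro ⟨q, hq, hq'⟩
          refine ⟨q + 1, by simpa using hq, ?_⟩
          simp only [List.take_succ_cons, List.flatten_cons, List.length_append]
          omega
      rw [List.getD_append_right _ _ _ _ (by simp; omega), List.length_map,
        Nat.sub_add_comm h]
      simp only [h1]

theorem length_flatten_take_lt (L : List (List (ℕ × ℕ))) (hL : ∀ R ∈ L, R ≠ []) {p q : ℕ}
    (hpq : p < q) (hq : q ≤ L.length) :
    (L.take p).flatten.length < (L.take q).flatten.length := by
  induction L generalizing p q with
  | nil => simp at hq; omega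
  | cons R L ih =>
    have hR := List.length_pos_iff.2 (hL R List.mem_cons_self)
    obtain ⟨q, rfl⟩ := Nat.exists_eq_add_one_of_ne_zero (by omega : q ≠ 0)
    cases p with
    | zero => simp; omega
    | succ p =>
      have := ih (fun S hS => hL S (List.mem_cons_of_mem _ hS)) (p := p) (q := q)
        (by omega) (by simpa using hq)
      simpa using this

end StringSorting

namespace WordRAM

variable {w : ℕ}

/-! ### Straight-line code and counting loops -/

/-- The straight-line program with the given instructions. -/
def Prog.ofList : List Instr → Prog
  | [] => .skip
  | I :: l => .seq (.instr I) (.ofList l)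

theorem exec_ofList {inp : ℕ → ℕ → BitVec w} {ω : ℕ → Fin (2 ^ w)} (l : List Instr)
    (s : State w) : Exec inp ω (.ofList l) s (l.foldl (Instr.exec inp ω) s) := by
  induction l generalizing s with
  | nil => exact .skip s
  | cons I l ih => exact .seq (.instr I s) (ih _)

/-- A loop whose body decreases the register `x` by one and takes at most `T` steps. The index of
the invariant `Inv` is the content of `x`. -/
theorem exec_countdown {inp : ℕ → ℕ → BitVec w} {ω : ℕ → Fin (2 ^ w)} {x : ℕ} {body : Prog}
    (Inv : ℕ → State w → Prop) (T : ℕ)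
    (hreg : ∀ j s, Inv j s → s.reg x = BitVec.ofNat w j)
    (htick : ∀ j s, Inv j s → Inv j s.tick) {n : ℕ} (hn : n < 2 ^ w)
    (hbody : ∀ j s, j < n → Inv (j + 1) s →
      ∃ s', Exec inp ω body s s' ∧ Inv j s' ∧ s'.steps ≤ s.steps + T)
    (s : State w) (hs : Inv n s) :
    ∃ s', Exec inp ω (.loop x body) s s' ∧ Inv 0 s' ∧ s'.steps ≤ s.steps + (T + 1) * n + 1 := by
  suffices H : ∀ j ≤ n, ∀ s, Inv j s → ∃ s', Exec inp ω (.loop x body) s s' ∧ Inv 0 s' ∧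
      s'.steps ≤ s.steps + (T + 1) * j + 1 from H n le_rfl s hs
  intro j
  induction j with
  | zero =>
    intro _ s h
    exact ⟨s.tick, .loop_false (hreg 0 s h), htick 0 s h, le_rfl⟩
  | succ j ih =>
    intro hj s h
    obtain ⟨s₁, h₁, h₁', h₁''⟩ := hbody j s.tick hj (htick _ s h)
    obtain ⟨s₂, h₂, h₂', h₂''⟩ := ih (by omega) s₁ h₁'
    refine ⟨s₂, .loop_true ?_ h₁ h₂, h₂', ?_⟩
    · rw [hreg _ s h]
      intro h0
      have := congrArg BitVec.toNat h0
      rw [BitVec.toNat_ofNat, Nat.mod_eq_of_lt (by omega)] at this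
      simp at this
    · have : s.tick.steps = s.steps + 1 := rfl
      rw [mul_add, mul_one]
      omega

/-! ### Simulation of a program whose third input array is stored in memory -/

/-- All registers and writable arrays that the instruction names are less than `N`. -/
def Instr.Below (N : ℕ) : Instr → Prop
  | .const r _ => r < N
  | .op _ r x y => r < N ∧ x < N ∧ y < N
  | .input r _ i => r < N ∧ i < N
  | .load r a i => r < N ∧ a < N ∧ i < N
  | .store a i x => a < N ∧ i < N ∧ x < N
  | .rand r => r < N

/-- All registers and writable arrays that the program names are less than `N`. -/
def Prog.Below (N : ℕ) : Prog → Prop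
  | .skip => True
  | .instr I => I.Below N
  | .seq P Q => P.Below N ∧ Q.Below N
  | .ite r P Q => r < N ∧ P.Below N ∧ Q.Below N
  | .loop r P => r < N ∧ P.Below N

theorem Instr.Below.mono {N N' : ℕ} (h : N ≤ N') {I : Instr} (hI : I.Below N) : I.Below N' := by
  cases I <;> simp only [Instr.Below] at hI ⊢ <;> omega

theorem Prog.Below.mono {N N' : ℕ} (h : N ≤ N') {P : Prog} (hP : P.Below N) : P.Below N' := by
  induction P with
  | skip => trivial
  | instr I => exact Instr.Below.mono h hP
  | seq P Q ihP ihQ => exact ⟨ihP hP.1, ihQ hP.2⟩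
  | ite r P Q ihP ihQ => exact ⟨hP.1.trans_le h, ihP hP.2.1, ihQ hP.2.2⟩
  | loop r P ih => exact ⟨hP.1.trans_le h, ih hP.2⟩

theorem Prog.exists_below (P : Prog) : ∃ N, P.Below N := by
  induction P with
  | skip => exact ⟨0, trivial⟩
  | instr I =>
    cases I with
    | const r c => exact ⟨r + 1, Nat.lt_succ_self r⟩
    | op o r x y => exact ⟨r + x + y + 1, by simp only [Below, Instr.Below]; omega⟩
    | input r a i => exact ⟨r + i + 1, by simp only [Below, Instr.Below]; omega⟩
    | load r a i => exact ⟨r + a + i + 1, by simp only [Below, Instr.Below]; omega⟩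
    | store a i x => exact ⟨a + i + x + 1, by simp only [Below, Instr.Below]; omega⟩
    | rand r => exact ⟨r + 1, Nat.lt_succ_self r⟩
  | seq P Q ihP ihQ =>
    obtain ⟨N, hN⟩ := ihP
    obtain ⟨N', hN'⟩ := ihQ
    exact ⟨max N N', hN.mono (le_max_left _ _), hN'.mono (le_max_right _ _)⟩
  | ite r P Q ihP ihQ =>
    obtain ⟨N, hN⟩ := ihP
    obtain ⟨N', hN'⟩ := ihQ
    exact ⟨max (r + 1) (max N N'), by omega, hN.mono (by omega), hN'.mono (by omega)⟩
  | loop r P ih =>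
    obtain ⟨N, hN⟩ := ih
    exact ⟨max (r + 1) N, by omega, hN.mono (by omega)⟩

/-- Program text for an instruction of the simulated program. Reading cell `2` of input array `0`
yields register `N + 3`, and input array `2` is replaced by the array `N`. The latter is accessed
only at positions less than register `N + 2`, so that out-of-range reads cost no space. -/
def Instr.simulate (N : ℕ) : Instr → Prog
  | .input x 0 i => .seq (.instr (.op .eq (N + 4) i (N + 1)))
      (.ite (N + 4) (.instr (.op .or x (N + 3) (N + 3))) (.instr (.input x 0 i)))
  | .input x 1 i => .instr (.input x 1 i)
  | .input x 2 i => .seq (.instr (.op .lt (N + 4) i (N + 2)))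
      (.ite (N + 4) (.instr (.load x N i)) (.instr (.const x 0)))
  | .input x _ _ => .instr (.const x 0)
  | I => .instr I

/-- The program with its reads from the input redirected to the prepared data. -/
def Prog.simulate (N : ℕ) : Prog → Prog
  | .skip => .skip
  | .instr I => I.simulate N
  | .seq P Q => .seq (P.simulate N) (Q.simulate N)
  | .ite r P Q => .ite r (P.simulate N) (Q.simulate N)
  | .loop r P => .loop r (P.simulate N)

theorem Prog.RandFree.simulate {N : ℕ} {P : Prog} (h : P.RandFree) :
    (P.simulate N).RandFree := by
  induction P with
  | skip => trivial
  | instr I =>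
    unfold Prog.simulate Instr.simulate
    split <;> simp_all [Prog.RandFree]
  | seq P Q ihP ihQ => exact ⟨ihP h.1, ihQ h.2⟩
  | ite r P Q ihP ihQ => exact ⟨ihP h.1, ihQ h.2⟩
  | loop r P ih => exact ih h

/-- The state `t` agrees with `s` on the names below `N` and has used at most `r` more words of
memory, all of them in the array `N`. -/
structure Shadows (N r : ℕ) (s t : State w) : Prop where
  reg : ∀ x < N, t.reg x = s.reg x
  mem : ∀ a < N, t.mem a = s.mem a
  ext : t.ext ≤ s.ext + Finsupp.single N r
  coins : t.coins = s.coins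

/-- The data prepared for the simulation: constants, the length `r` of the text, the alphabet size
`W`, and the text `f`. -/
structure Prepared (N r : ℕ) (W : BitVec w) (f : ℕ → BitVec w) (t : State w) : Prop where
  two : t.reg (N + 1) = BitVec.ofNat w 2
  len : t.reg (N + 2) = BitVec.ofNat w r
  size : t.reg (N + 3) = W
  text : ∀ j < r, t.mem N (BitVec.ofNat w j) = f j

theorem Shadows.space_le {N r : ℕ} {s t : State w} (h : Shadows N r s t) :
    t.space ≤ s.space + r := by
  obtain ⟨e, he⟩ := le_iff_exists_add.1 h.ext
  have h1 : (s.ext + Finsupp.single N r).sum (fun _ n => n) = s.ext.sum (fun _ n => n) + r := by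
    rw [Finsupp.sum_add_index' (fun _ => rfl) (fun _ _ _ => rfl), Finsupp.sum_single_index rfl]
  have h2 := Finsupp.sum_add_index' (f := t.ext) (g := e) (h := fun _ n => n)
    (fun _ => rfl) (fun _ _ _ => rfl)
  rw [← he, h1] at h2
  unfold State.space
  omega

theorem Shadows.tick {N r : ℕ} {s t : State w} (h : Shadows N r s t) :
    Shadows N r s.tick t.tick := ⟨h.reg, h.mem, h.ext, h.coins⟩

theorem Shadows.tick_right {N r : ℕ} {s t : State w} (h : Shadows N r s t) :
    Shadows N r s t.tick := ⟨h.reg, h.mem, h.ext, h.coins⟩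

theorem Shadows.setReg_right {N r : ℕ} {s t : State w} (h : Shadows N r s t) {x : ℕ}
    (hx : N ≤ x) (v : BitVec w) : Shadows N r s (t.setReg x v) := by
  refine ⟨fun y hy => ?_, h.mem, h.ext, h.coins⟩
  simp only [State.setReg]
  rw [Function.update_of_ne (by omega), h.reg y hy]

theorem Shadows.setReg {N r : ℕ} {s t : State w} (h : Shadows N r s t) (x : ℕ)
    (v : BitVec w) : Shadows N r (s.setReg x v) (t.setReg x v) := by
  refine ⟨fun y hy => ?_, h.mem, h.ext, h.coins⟩
  simp only [State.setReg, Function.update_apply]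
  rw [h.reg y hy]

theorem Shadows.touch {N r : ℕ} {s t : State w} (h : Shadows N r s t) (a : ℕ) (i : BitVec w) :
    Shadows N r (s.touch a i) (t.touch a i) := by
  refine ⟨h.reg, h.mem, fun b => ?_, h.coins⟩
  have hb := h.ext b
  have ha := h.ext a
  simp only [State.touch, Finsupp.add_apply, Finsupp.update_apply] at *
  split_ifs with hab
  · subst hab; omega
  · exact hb

theorem Shadows.touch_right {N r : ℕ} {s t : State w} (h : Shadows N r s t) {i : BitVec w}
    (hi : i.toNat < r) : Shadows N r s (t.touch N i) := by
  refine ⟨h.reg, h.mem, fun b => ?_, h.coins⟩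
  have hb := h.ext b
  simp only [State.touch, Finsupp.add_apply, Finsupp.update_apply] at *
  split_ifs with hab
  · subst hab
    rw [Finsupp.single_eq_same] at *
    omega
  · exact hb

theorem Shadows.setMem {N r : ℕ} {s t : State w} (h : Shadows N r s t) {a : ℕ} (ha : a < N)
    (i v : BitVec w) : Shadows N r (s.setMem a i v) (t.setMem a i v) := by
  refine ⟨h.reg, fun b hb => ?_, h.ext, h.coins⟩
  simp only [State.setMem, Function.update_apply]
  rw [h.mem b hb, h.mem a ha]

theorem Shadows.setMem_right {N r : ℕ} {s t : State w} (h : Shadows N r s t)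
    (i v : BitVec w) : Shadows N r s (t.setMem N i v) := by
  refine ⟨h.reg, fun b hb => ?_, h.ext, h.coins⟩
  simp only [State.setMem]
  rw [Function.update_of_ne (by omega), h.mem b hb]

theorem Prepared.tick {N r : ℕ} {W : BitVec w} {f : ℕ → BitVec w} {t : State w}
    (h : Prepared N r W f t) : Prepared N r W f t.tick := ⟨h.two, h.len, h.size, h.text⟩

theorem Prepared.touch {N r : ℕ} {W : BitVec w} {f : ℕ → BitVec w} {t : State w}
    (h : Prepared N r W f t) (a : ℕ) (i : BitVec w) : Prepared N r W f (t.touch a i) :=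
  ⟨h.two, h.len, h.size, h.text⟩

theorem Prepared.setReg {N r : ℕ} {W : BitVec w} {f : ℕ → BitVec w} {t : State w}
    (h : Prepared N r W f t) {x : ℕ} (hx : x < N ∨ N + 3 < x) (v : BitVec w) :
    Prepared N r W f (t.setReg x v) := by
  refine ⟨?_, ?_, ?_, h.text⟩ <;> simp only [State.setReg] <;>
    rw [Function.update_of_ne (by omega)]
  exacts [h.two, h.len, h.size]

theorem Prepared.setMem {N r : ℕ} {W : BitVec w} {f : ℕ → BitVec w} {t : State w}
    (h : Prepared N r W f t) {a : ℕ} (ha : a < N) (i v : BitVec w) :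
    Prepared N r W f (t.setMem a i v) := by
  refine ⟨h.two, h.len, h.size, fun j hj => ?_⟩
  simp only [State.setMem]
  rw [Function.update_of_ne (by omega), h.text j hj]

/-- The input `inp` of the simulated program, in terms of the input `inp'` of the simulation and
the prepared data. -/
structure InputMatches (r : ℕ) (W : BitVec w) (f : ℕ → BitVec w) (inp inp' : ℕ → ℕ → BitVec w) :
    Prop where
  numbers : ∀ j, inp 0 j = if j = 2 then W else inp' 0 j
  offsets : ∀ j, inp 1 j = inp' 1 j
  text : ∀ j, inp 2 j = if j < r then f j else 0
  rest : ∀ a j, inp (a + 3) j = 0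

theorem exec_simulate_input {N r : ℕ} {W : BitVec w} {f : ℕ → BitVec w}
    {inp inp' : ℕ → ℕ → BitVec w} {ω : ℕ → Fin (2 ^ w)} (hin : InputMatches r W f inp inp')
    (hw : 2 < 2 ^ w) (hr : r < 2 ^ w) {x a i : ℕ} (hx : x < N) (hi : i < N) {s t : State w}
    (hst : Shadows N r s t) (ht : Prepared N r W f t) :
    ∃ t', Exec inp' ω ((Instr.input x a i).simulate N) t t' ∧
      Shadows N r (Instr.exec inp ω s (.input x a i)) t' ∧ Prepared N r W f t' ∧
      t'.steps ≤ t.steps + 3 := by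
  have hne : (BitVec.ofNat w 1 : BitVec w) ≠ 0 := by
    intro h
    have := congrArg BitVec.toNat h
    rw [BitVec.toNat_ofNat, Nat.mod_eq_of_lt (by omega)] at this
    simp at this
  match a with
  | 0 =>
    simp only [Instr.exec, Instr.simulate]
    set t₁ := Instr.exec inp' ω t (.op .eq (N + 4) i (N + 1)) with ht₁
    have hs₁ : Shadows N r s t₁ := (hst.setReg_right (by omega) _).tick_right
    have hp₁ : Prepared N r W f t₁ := (ht.setReg (by omega) _).tick
    have hc : t₁.reg (N + 4) = if (s.reg i).toNat = 2 then BitVec.ofNat w 1 else 0 := by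
      simp only [ht₁, Instr.exec, State.tick, State.setReg, Function.update_self, BinOp.eval,
        ht.two, hst.reg i hi]
      have : s.reg i = BitVec.ofNat w 2 ↔ (s.reg i).toNat = 2 := by
        rw [BitVec.toNat_eq, BitVec.toNat_ofNat, Nat.mod_eq_of_lt hw]
      simp [this]
    rw [hin.numbers]
    split_ifs at hc ⊢ with h2
    · refine ⟨_, .seq (.instr _ _) (.ite_true (by rw [hc]; exact hne) (.instr _ _)), ?_, ?_,
        le_rfl⟩
      · have : BinOp.eval .or (t₁.tick.reg (N + 3)) (t₁.tick.reg (N + 3)) = W := by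
          rw [hp₁.tick.size]
          exact BitVec.or_self
        change Shadows N r _ (t₁.tick.setReg x
          (BinOp.eval .or (t₁.tick.reg (N + 3)) (t₁.tick.reg (N + 3)))).tick
        rw [this]
        exact (hs₁.tick_right.setReg x W).tick
      · exact (hp₁.tick.setReg (Or.inl hx) _).tick
    · refine ⟨_, .seq (.instr _ _) (.ite_false hc (.instr _ _)), ?_, ?_, le_rfl⟩
      · change Shadows N r _ (t₁.tick.setReg x (inp' 0 (t₁.tick.reg i).toNat)).tick
        rw [hs₁.tick_right.reg i hi]
        exact (hs₁.tick_right.setReg x _).tick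
      · exact (hp₁.tick.setReg (Or.inl hx) _).tick
  | 1 =>
    refine ⟨_, .instr _ _, ?_, (ht.setReg (Or.inl hx) _).tick,
      Nat.add_le_add_left (by norm_num) _⟩
    simp only [Instr.exec, hin.offsets, hst.reg i hi]
    exact (hst.setReg x _).tick
  | 2 =>
    simp only [Instr.exec, Instr.simulate]
    set t₁ := Instr.exec inp' ω t (.op .lt (N + 4) i (N + 2)) with ht₁
    have hs₁ : Shadows N r s t₁ := (hst.setReg_right (by omega) _).tick_right
    have hp₁ : Prepared N r W f t₁ := (ht.setReg (by omega) _).tick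
    have hc : t₁.reg (N + 4) = if (s.reg i).toNat < r then BitVec.ofNat w 1 else 0 := by
      simp only [ht₁, Instr.exec, State.tick, State.setReg, Function.update_self, BinOp.eval,
        ht.len, hst.reg i hi]
      rw [BitVec.toNat_ofNat, Nat.mod_eq_of_lt hr]
      rfl
    rw [hin.text]
    split_ifs at hc ⊢ with h2
    · refine ⟨_, .seq (.instr _ _) (.ite_true (by rw [hc]; exact hne) (.instr _ _)), ?_, ?_,
        le_rfl⟩
      · have := hp₁.tick.text _ h2
        rw [BitVec.ofNat_toNat, BitVec.setWidth_eq] at this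
        change Shadows N r _ ((t₁.tick.setReg x (t₁.tick.mem N (t₁.tick.reg i))).touch N
          (t₁.tick.reg i)).tick
        rw [hs₁.tick_right.reg i hi, this]
        exact ((hs₁.tick_right.setReg x _).touch_right h2).tick
      · exact ((hp₁.tick.setReg (Or.inl hx) _).touch _ _).tick
    · refine ⟨_, .seq (.instr _ _) (.ite_false hc (.instr _ _)), ?_, ?_, le_rfl⟩
      · exact (hs₁.tick_right.setReg x _).tick
      · exact (hp₁.tick.setReg (Or.inl hx) _).tick
  | a + 3 =>
    refine ⟨_, .instr _ _, ?_, (ht.setReg (Or.inl hx) _).tick,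
      Nat.add_le_add_left (by norm_num) _⟩
    simp only [Instr.exec, hin.rest]
    exact (hst.setReg x _).tick

theorem exec_simulate_instr {N r : ℕ} {W : BitVec w} {f : ℕ → BitVec w}
    {inp inp' : ℕ → ℕ → BitVec w} {ω : ℕ → Fin (2 ^ w)} (hin : InputMatches r W f inp inp')
    (hw : 2 < 2 ^ w) (hr : r < 2 ^ w) {I : Instr} (hI : I.Below N) {s t : State w}
    (hst : Shadows N r s t) (ht : Prepared N r W f t) :
    ∃ t', Exec inp' ω (I.simulate N) t t' ∧ Shadows N r (I.exec inp ω s) t' ∧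
      Prepared N r W f t' ∧ t'.steps ≤ t.steps + 3 := by
  cases I with
  | const x c =>
    exact ⟨_, .instr _ _, (hst.setReg x _).tick, (ht.setReg (Or.inl hI) _).tick,
      Nat.add_le_add_left (by norm_num) _⟩
  | op o x y z =>
    obtain ⟨hx, hy, hz⟩ := hI
    refine ⟨_, .instr _ _, ?_, (ht.setReg (Or.inl hx) _).tick,
      Nat.add_le_add_left (by norm_num) _⟩
    simp only [Instr.exec, hst.reg y hy, hst.reg z hz]
    exact (hst.setReg x _).tick
  | input x a i => exact exec_simulate_input hin hw hr hI.1 hI.2 hst ht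
  | load x a i =>
    obtain ⟨hx, ha, hi⟩ := hI
    refine ⟨_, .instr _ _, ?_, ((ht.setReg (Or.inl hx) _).touch _ _).tick,
      Nat.add_le_add_left (by norm_num) _⟩
    simp only [Instr.exec, hst.reg i hi, hst.mem a ha]
    exact ((hst.setReg x _).touch a _).tick
  | store a i x =>
    obtain ⟨ha, hi, hx⟩ := hI
    refine ⟨_, .instr _ _, ?_, ((ht.setMem ha _ _).touch _ _).tick,
      Nat.add_le_add_left (by norm_num) _⟩
    simp only [Instr.exec, hst.reg i hi, hst.reg x hx]
    exact ((hst.setMem ha _ _).touch a _).tick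
  | rand x =>
    refine ⟨_, .instr _ _, ?_, ?_, Nat.add_le_add_left (by norm_num) t.steps⟩
    · have h := (hst.setReg x (BitVec.ofFin (ω s.coins))).tick
      simp only [Instr.exec, hst.coins]
      exact ⟨h.reg, h.mem, h.ext, rfl⟩
    · have h := (ht.setReg (Or.inl hI) (BitVec.ofFin (ω t.coins))).tick
      exact ⟨h.two, h.len, h.size, h.text⟩

/-- The simulation follows every halting computation, on the same random words, with at most three
steps for one. -/
theorem Exec.simulate {N r : ℕ} {W : BitVec w} {f : ℕ → BitVec w}
    {inp inp' : ℕ → ℕ → BitVec w} {ω : ℕ → Fin (2 ^ w)} (hin : InputMatches r W f inp inp')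
    (hw : 2 < 2 ^ w) (hr : r < 2 ^ w) {P : Prog} {s s' : State w} (h : Exec inp ω P s s')
    (hP : P.Below N) {t : State w} (hst : Shadows N r s t) (ht : Prepared N r W f t) :
    ∃ t', Exec inp' ω (P.simulate N) t t' ∧ Shadows N r s' t' ∧ Prepared N r W f t' ∧
      t'.steps + 3 * s.steps ≤ t.steps + 3 * s'.steps := by
  have htick : ∀ u : State w, u.tick.steps = u.steps + 1 := fun _ => rfl
  induction h generalizing t with
  | skip s => exact ⟨t, .skip t, hst, ht, le_rfl⟩
  | instr I s =>
    obtain ⟨t', h₁, h₂, h₃, h₄⟩ := exec_simulate_instr (ω := ω) hin hw hr hP hst ht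
    refine ⟨t', h₁, h₂, h₃, ?_⟩
    have : (I.exec inp ω s).steps = s.steps + 1 := by cases I <;> rfl
    omega
  | seq _ _ ih₁ ih₂ =>
    obtain ⟨t₁, h₁, hs₁, hp₁, hle₁⟩ := ih₁ hP.1 hst ht
    obtain ⟨t₂, h₂, hs₂, hp₂, hle₂⟩ := ih₂ hP.2 hs₁ hp₁
    exact ⟨t₂, .seq h₁ h₂, hs₂, hp₂, by omega⟩
  | @ite_true x P Q s s' hx _ ih =>
    obtain ⟨t₁, h₁, hs₁, hp₁, hle₁⟩ := ih hP.2.1 hst.tick ht.tick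
    refine ⟨t₁, .ite_true (by rwa [hst.reg x hP.1]) h₁, hs₁, hp₁, ?_⟩
    simp only [htick] at hle₁
    omega
  | @ite_false x P Q s s' hx _ ih =>
    obtain ⟨t₁, h₁, hs₁, hp₁, hle₁⟩ := ih hP.2.2 hst.tick ht.tick
    refine ⟨t₁, .ite_false (by rwa [hst.reg x hP.1]) h₁, hs₁, hp₁, ?_⟩
    simp only [htick] at hle₁
    omega
  | @loop_true x P s s' s'' hx _ _ ih₁ ih₂ =>
    obtain ⟨t₁, h₁, hs₁, hp₁, hle₁⟩ := ih₁ hP.2 hst.tick ht.tick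
    obtain ⟨t₂, h₂, hs₂, hp₂, hle₂⟩ := ih₂ hP hs₁ hp₁
    refine ⟨t₂, .loop_true (by rwa [hst.reg x hP.1]) h₁ h₂, hs₂, hp₂, ?_⟩
    simp only [htick] at hle₁
    omega
  | @loop_false x P s hx =>
    refine ⟨t.tick, .loop_false (by rwa [hst.reg x hP.1]), hst.tick, ht.tick, ?_⟩
    simp only [htick]
    omega

end WordRAM

namespace WordRAM

variable {w : ℕ}

/-! ### Preparing the text -/

section Reads

variable (inp : ℕ → ℕ → BitVec w) (ω : ℕ → Fin (2 ^ w)) (s : State w)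

theorem reg_exec_const (x c y : ℕ) : (Instr.exec inp ω s (.const x c)).reg y =
    if y = x then BitVec.ofNat w c else s.reg y := Function.update_apply ..

theorem reg_exec_op (o : BinOp) (x a b y : ℕ) : (Instr.exec inp ω s (.op o x a b)).reg y =
    if y = x then o.eval (s.reg a) (s.reg b) else s.reg y := Function.update_apply ..

theorem reg_exec_input (x a i y : ℕ) : (Instr.exec inp ω s (.input x a i)).reg y =
    if y = x then inp a (s.reg i).toNat else s.reg y := Function.update_apply ..

theorem reg_exec_store (a i x y : ℕ) : (Instr.exec inp ω s (.store a i x)).reg y = s.reg y := rfl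

end Reads

theorem eval_add_ofNat (a b : ℕ) :
    BinOp.add.eval (BitVec.ofNat w a) (BitVec.ofNat w b) = BitVec.ofNat w (a + b) :=
  (BitVec.ofNat_add a b).symm

theorem eval_mul_ofNat (a b : ℕ) :
    BinOp.mul.eval (BitVec.ofNat w a) (BitVec.ofNat w b) = BitVec.ofNat w (a * b) :=
  (BitVec.ofNat_mul a b).symm

theorem eval_sub_ofNat {a b : ℕ} (h : b ≤ a) (hb : b < 2 ^ w) :
    BinOp.sub.eval (BitVec.ofNat w a) (BitVec.ofNat w b) = BitVec.ofNat w (a - b) :=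
  BitVec.ofNat_sub_ofNat_of_le a b hb h

theorem eval_or_self (v : BitVec w) : BinOp.or.eval v v = v := BitVec.or_self

theorem eval_lt_ofNat {a b : ℕ} (ha : a < 2 ^ w) (hb : b < 2 ^ w) :
    BinOp.lt.eval (BitVec.ofNat w a) (BitVec.ofNat w b) =
      BitVec.ofNat w (if a < b then 1 else 0) := by
  simp only [BinOp.eval, BitVec.toNat_ofNat, Nat.mod_eq_of_lt ha, Nat.mod_eq_of_lt hb]
  split_ifs <;> rfl

theorem eval_eq_ofNat {a b : ℕ} (ha : a < 2 ^ w) (hb : b < 2 ^ w) :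
    BinOp.eq.eval (BitVec.ofNat w a) (BitVec.ofNat w b) =
      BitVec.ofNat w (if a = b then 1 else 0) := by
  have : BitVec.ofNat w a = BitVec.ofNat w b ↔ a = b := by
    rw [BitVec.toNat_eq, BitVec.toNat_ofNat, BitVec.toNat_ofNat, Nat.mod_eq_of_lt ha,
      Nat.mod_eq_of_lt hb]
  simp only [BinOp.eval, this]
  split_ifs <;> rfl

/-- The instruction writes only to a register with a name at least `N`. -/
def Instr.Fresh (N : ℕ) : Instr → Prop
  | .const r _ => N ≤ r
  | .op _ r _ _ => N ≤ r
  | .input r _ _ => N ≤ r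
  | _ => False

theorem Shadows.foldl_exec {N r : ℕ} {inp : ℕ → ℕ → BitVec w} {ω : ℕ → Fin (2 ^ w)}
    {l : List Instr} (hl : ∀ I ∈ l, I.Fresh N) {s t : State w} (h : Shadows N r s t) :
    Shadows N r s (l.foldl (Instr.exec inp ω) t) := by
  induction l generalizing t with
  | nil => exact h
  | cons I l ih =>
    refine ih (fun J hJ => hl J (List.mem_cons_of_mem _ hJ)) ?_
    have hI := hl I List.mem_cons_self
    cases I <;> first | exact hI.elim | exact (h.setReg_right hI _).tick_right

theorem mem_foldl_exec {N : ℕ} {inp : ℕ → ℕ → BitVec w} {ω : ℕ → Fin (2 ^ w)}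
    {l : List Instr} (hl : ∀ I ∈ l, I.Fresh N) (t : State w) :
    (l.foldl (Instr.exec inp ω) t).mem = t.mem := by
  induction l generalizing t with
  | nil => rfl
  | cons I l ih =>
    have hI := hl I List.mem_cons_self
    refine (ih (fun J hJ => hl J (List.mem_cons_of_mem _ hJ)) _).trans ?_
    cases I <;> first | exact hI.elim | rfl

theorem steps_foldl_exec {inp : ℕ → ℕ → BitVec w} {ω : ℕ → Fin (2 ^ w)}
    (l : List Instr) (t : State w) :
    (l.foldl (Instr.exec inp ω) t).steps = t.steps + l.length := by
  induction l generalizing t with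
  | nil => rfl
  | cons I l ih =>
    have : (I.exec inp ω t).steps = t.steps + 1 := by cases I <;> rfl
    rw [List.foldl_cons, ih, this, List.length_cons]
    omega

/-- Registers `N` and `N + 1` receive the constants `1` and `2`, registers `N + 2` and `N + 6` the
number of runs. -/
def setupCode (N : ℕ) : List Instr :=
  [.const N 1, .const (N + 1) 2, .input (N + 2) 0 N, .input (N + 6) 0 N]

/-- Adds the length of the run before position `N + 6` to register `N + 5`. -/
def sumCode (N : ℕ) : List Instr :=
  [.op .sub (N + 6) (N + 6) N, .input (N + 7) 3 (N + 6), .op .add (N + 5) (N + 5) (N + 7)]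

/-- Register `N + 3` receives the size of the new alphabet, register `N + 8` the number of strings,
register `N + 6` the number of runs. Register `N + 10` still contains `0`. -/
def resetCode (N : ℕ) : List Instr :=
  [.input (N + 3) 0 (N + 1), .op .mul (N + 3) (N + 3) (N + 5), .input (N + 8) 0 (N + 10),
    .input (N + 6) 0 N]

/-- Computes the letter of the run before position `N + 6` in register `N + 14`. Register `N + 8`
is the number of strings that end at that position or earlier, register `N + 10` the character of
the next run, or `0` if there is none. The choices between two values are made arithmetically, with
truth values as factors. -/
def letterCode (N : ℕ) : List Instr :=
  [.op .or (N + 11) (N + 6) (N + 6), .op .sub (N + 6) (N + 6) N,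
    .input (N + 9) 2 (N + 6), .input (N + 7) 3 (N + 6),
    .input (N + 4) 1 (N + 8), .op .eq (N + 4) (N + 4) (N + 11), .op .sub (N + 8) (N + 8) (N + 4),
    .op .sub (N + 13) N (N + 4), .op .mul (N + 10) (N + 10) (N + 13),
    .op .lt (N + 4) (N + 9) (N + 10), .op .sub (N + 12) N (N + 4),
    .op .sub (N + 14) (N + 5) (N + 7), .op .mul (N + 14) (N + 4) (N + 14),
    .op .sub (N + 13) (N + 7) N, .op .mul (N + 13) (N + 12) (N + 13),
    .op .add (N + 14) (N + 14) (N + 13), .op .mul (N + 13) (N + 9) (N + 5),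
    .op .add (N + 14) (N + 13) (N + 14), .op .or (N + 10) (N + 9) (N + 9)]

/-- Computes the total length, the new alphabet size and the text of letters, stored in the
array `N`. -/
def prepare (N : ℕ) : Prog :=
  .seq (.ofList (setupCode N)) (.seq (.loop (N + 6) (.ofList (sumCode N)))
    (.seq (.ofList (resetCode N))
      (.loop (N + 6) (.seq (.ofList (letterCode N)) (.instr (.store N (N + 6) (N + 14)))))))

theorem Prog.randFree_ofList {N : ℕ} {l : List Instr} (hl : ∀ I ∈ l, I.Fresh N) :
    (Prog.ofList l).RandFree := by
  induction l with
  | nil => trivial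
  | cons I l ih =>
    refine ⟨?_, ih fun J hJ => hl J (List.mem_cons_of_mem _ hJ)⟩
    have hI := hl I List.mem_cons_self
    cases I <;> first | exact hI.elim | trivial

theorem fresh_setupCode (N : ℕ) : ∀ I ∈ setupCode N, I.Fresh N := by
  simp [setupCode, Instr.Fresh]

theorem fresh_sumCode (N : ℕ) : ∀ I ∈ sumCode N, I.Fresh N := by
  simp [sumCode, Instr.Fresh]

theorem fresh_resetCode (N : ℕ) : ∀ I ∈ resetCode N, I.Fresh N := by
  simp [resetCode, Instr.Fresh]

theorem fresh_letterCode (N : ℕ) : ∀ I ∈ letterCode N, I.Fresh N := by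
  simp [letterCode, Instr.Fresh]

theorem randFree_prepare (N : ℕ) : (prepare N).RandFree :=
  ⟨Prog.randFree_ofList (fresh_setupCode N), Prog.randFree_ofList (fresh_sumCode N),
    Prog.randFree_ofList (fresh_resetCode N), Prog.randFree_ofList (fresh_letterCode N), trivial⟩

/-- A run-length encoded input: `k` strings with `r` runs and total length `M` over an alphabet of
size `σ`, the offsets `o`, the characters `c` and the lengths `l` of the runs. Reading behind the
last character yields the padding `c r = 0`. -/
structure RunInput (inp : ℕ → ℕ → BitVec w) (k r σ M : ℕ) (o c l : ℕ → ℕ) : Prop where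
  inp_k : inp 0 0 = BitVec.ofNat w k
  inp_r : inp 0 1 = BitVec.ofNat w r
  inp_σ : inp 0 2 = BitVec.ofNat w σ
  inp_o : ∀ q, inp 1 q = BitVec.ofNat w (o q)
  inp_c : ∀ j, inp 2 j = BitVec.ofNat w (c j)
  inp_l : ∀ j, inp 3 j = BitVec.ofNat w (l j)
  two_lt : 2 < 2 ^ w
  k_lt : k < 2 ^ w
  r_lt : r < 2 ^ w
  M_lt : M < 2 ^ w
  c_lt : ∀ j, c j < 2 ^ w
  c_r : c r = 0
  l_pos : ∀ j < r, 0 < l j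
  l_le : ∀ j < r, l j ≤ M
  sum_l : ∑ j ∈ Finset.range r, l j = M
  o_zero : o 0 = 0
  o_k : o k = r
  o_lt : ∀ p q, p < q → q ≤ k → o p < o q

open Classical in
/-- The letter at position `j` of the text to be sorted instead. -/
noncomputable def newText (k M : ℕ) (o c l : ℕ → ℕ) (j : ℕ) : ℕ :=
  StringSorting.runLetter M (c j) (l j) (if ∃ q ≤ k, o q = j + 1 then 0 else c (j + 1))

/-- Invariant of the summation loop. -/
structure SumInv (N r : ℕ) (l : ℕ → ℕ) (j : ℕ) (s : State w) : Prop where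
  shadows : Shadows N r (State.init w) s
  one : s.reg N = BitVec.ofNat w 1
  two : s.reg (N + 1) = BitVec.ofNat w 2
  len : s.reg (N + 2) = BitVec.ofNat w r
  sum : s.reg (N + 5) = BitVec.ofNat w (∑ i ∈ Finset.Ico j r, l i)
  pos : s.reg (N + 6) = BitVec.ofNat w j
  next : s.reg (N + 10) = BitVec.ofNat w 0
  le : j ≤ r

/-- Invariant of the loop that computes the letters. -/
structure LetterInv (N k r σ M : ℕ) (o c l : ℕ → ℕ) (j : ℕ) (s : State w) : Prop where
  shadows : Shadows N r (State.init w) s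
  one : s.reg N = BitVec.ofNat w 1
  two : s.reg (N + 1) = BitVec.ofNat w 2
  len : s.reg (N + 2) = BitVec.ofNat w r
  size : s.reg (N + 3) = BitVec.ofNat w (σ * M)
  sum : s.reg (N + 5) = BitVec.ofNat w M
  pos : s.reg (N + 6) = BitVec.ofNat w j
  str : ∃ p ≤ k, s.reg (N + 8) = BitVec.ofNat w p ∧ ∀ q ≤ k, q ≤ p ↔ o q ≤ j
  next : s.reg (N + 10) = BitVec.ofNat w (c j)
  text : ∀ i, j ≤ i → i < r →
    s.mem N (BitVec.ofNat w i) = BitVec.ofNat w (newText k M o c l i)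

section Prepare

variable {inp : ℕ → ℕ → BitVec w} {ω : ℕ → Fin (2 ^ w)} {k r σ M : ℕ} {o c l : ℕ → ℕ}

theorem exec_sumCode (hI : RunInput inp k r σ M o c l) {N j : ℕ} {s : State w}
    (h : SumInv N r l (j + 1) s) :
    SumInv N r l j ((sumCode N).foldl (Instr.exec inp ω) s) := by
  have hj : (BitVec.ofNat w j).toNat = j := by
    rw [BitVec.toNat_ofNat, Nat.mod_eq_of_lt]
    have := h.le
    have := hI.r_lt
    omega
  have h1 : BinOp.sub.eval (BitVec.ofNat w (j + 1)) (BitVec.ofNat w 1) = BitVec.ofNat w j :=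
    eval_sub_ofNat (by omega) (by have := hI.two_lt; omega)
  have hsum : ∑ i ∈ Finset.Ico j r, l i = ∑ i ∈ Finset.Ico (j + 1) r, l i + l j := by
    rw [Finset.sum_eq_sum_Ico_succ_bot h.le, add_comm]
  refine ⟨h.shadows.foldl_exec (fresh_sumCode N), ?_, ?_, ?_, ?_, ?_, ?_, by have := h.le; omega⟩
  all_goals simp [sumCode, reg_exec_op, reg_exec_input, h.one, h.two, h.len, h.sum, h.pos, h.next,
    h1, hj, hI.inp_l, eval_add_ofNat, -BitVec.ofNat_eq_ofNat, hsum]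

theorem exec_letterCode (hI : RunInput inp k r σ M o c l) {N j : ℕ} (hjr : j < r) {s : State w}
    (h : LetterInv N k r σ M o c l (j + 1) s) :
    LetterInv N k r σ M o c l j (Instr.exec inp ω
      ((letterCode N).foldl (Instr.exec inp ω) s) (.store N (N + 6) (N + 14))) := by
  obtain ⟨p, hpk, hp, hpo⟩ := h.str
  have hw := hI.two_lt
  have hr := hI.r_lt
  have hM := hI.M_lt
  have hl1 := hI.l_pos j hjr
  have hl2 := hI.l_le j hjr
  have hk := hI.k_lt
  have hle : ∀ q ≤ k, o q ≤ r := by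
    intro q hq
    rcases hq.lt_or_eq with hq | rfl
    · rw [← hI.o_k]
      exact (hI.o_lt q k hq le_rfl).le
    · exact hI.o_k.le
  have hex : (∃ q ≤ k, o q = j + 1) ↔ o p = j + 1 := by
    refine ⟨?_, fun h => ⟨p, hpk, h⟩⟩
    rintro ⟨q, hq, hqj⟩
    have h1 : q ≤ p := (hpo q hq).2 hqj.le
    have h2 : o p ≤ j + 1 := (hpo p hpk).1 le_rfl
    rcases h1.lt_or_eq with h1 | rfl
    · have := hI.o_lt q p h1 hpk
      omega
    · exact hqj
  have hjn : (BitVec.ofNat w j).toNat = j := by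
    rw [BitVec.toNat_ofNat, Nat.mod_eq_of_lt (by omega)]
  have hpn : (BitVec.ofNat w p).toNat = p := by
    rw [BitVec.toNat_ofNat, Nat.mod_eq_of_lt (by omega)]
  -- `e` tells whether the run is the last one of its string, `d` is the next character in the
  -- string, `g` tells whether it is larger
  set e := if o p = j + 1 then 1 else 0 with he
  have he1 : e ≤ 1 := by rw [he]; split_ifs <;> omega
  have hep : e ≤ p := by
    rw [he]
    split_ifs with h0
    · rcases Nat.eq_zero_or_pos p with rfl | h1
      · rw [hI.o_zero] at h0; omega
      · exact h1
    · omega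
  set d := c (j + 1) * (1 - e) with hd
  have hd' : d = if ∃ q ≤ k, o q = j + 1 then 0 else c (j + 1) := by
    simp only [hex, hd, he]
    split_ifs <;> simp
  have hdlt : d < 2 ^ w := by
    rw [hd']
    split_ifs
    · omega
    · exact hI.c_lt _
  set g := if c j < d then 1 else 0 with hg
  have hg1 : g ≤ 1 := by rw [hg]; split_ifs <;> omega
  have h1 : BinOp.sub.eval (BitVec.ofNat w (j + 1)) (BitVec.ofNat w 1) = BitVec.ofNat w j :=
    eval_sub_ofNat (by omega) (by omega)
  have h2 : BinOp.eq.eval (BitVec.ofNat w (o p)) (BitVec.ofNat w (j + 1)) = BitVec.ofNat w e :=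
    eval_eq_ofNat ((hle p hpk).trans_lt hr) (by omega)
  have h3 : BinOp.sub.eval (BitVec.ofNat w p) (BitVec.ofNat w e) = BitVec.ofNat w (p - e) :=
    eval_sub_ofNat hep (by omega)
  have h4 : BinOp.sub.eval (BitVec.ofNat w 1) (BitVec.ofNat w e) = BitVec.ofNat w (1 - e) :=
    eval_sub_ofNat he1 (by omega)
  have h5 : BinOp.lt.eval (BitVec.ofNat w (c j)) (BitVec.ofNat w d) = BitVec.ofNat w g :=
    eval_lt_ofNat (hI.c_lt _) hdlt
  have h6 : BinOp.sub.eval (BitVec.ofNat w 1) (BitVec.ofNat w g) = BitVec.ofNat w (1 - g) :=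
    eval_sub_ofNat hg1 (by omega)
  have h7 : BinOp.sub.eval (BitVec.ofNat w M) (BitVec.ofNat w (l j)) = BitVec.ofNat w (M - l j) :=
    eval_sub_ofNat hl2 (by omega)
  have h8 : BinOp.sub.eval (BitVec.ofNat w (l j)) (BitVec.ofNat w 1) = BitVec.ofNat w (l j - 1) :=
    eval_sub_ofNat hl1 (by omega)
  have h9 : BinOp.mul.eval (BitVec.ofNat w (c (j + 1))) (BitVec.ofNat w (1 - e)) =
      BitVec.ofNat w d := eval_mul_ofNat _ _
  have hv : c j * M + (g * (M - l j) + (1 - g) * (l j - 1)) = newText k M o c l j := by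
    rw [newText, ← hd', StringSorting.runLetter, hg]
    split_ifs <;> simp
  have hr0 := h.one
  have hr1 := h.two
  have hr2 := h.len
  have hr3 := h.size
  have hr5 := h.sum
  have hr6 := h.pos
  have hr10 := h.next
  have hsh : Shadows N r (State.init w) ((letterCode N).foldl (Instr.exec inp ω) s) :=
    h.shadows.foldl_exec (fresh_letterCode N)
  have hmem : ((letterCode N).foldl (Instr.exec inp ω) s).mem = s.mem :=
    mem_foldl_exec (fresh_letterCode N) s
  have h6' : ((letterCode N).foldl (Instr.exec inp ω) s).reg (N + 6) = BitVec.ofNat w j := by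
    simp [letterCode, reg_exec_op, reg_exec_input, hr0, hr6, h1, -BitVec.ofNat_eq_ofNat]
  have h14' : ((letterCode N).foldl (Instr.exec inp ω) s).reg (N + 14) =
      BitVec.ofNat w (newText k M o c l j) := by
    simp [letterCode, reg_exec_op, reg_exec_input, hr0, hr5, hr6, hp, hr10, hjn, hpn, h1, h2, h4,
      h5, h6, h7, h8, h9, hI.inp_o, hI.inp_c, hI.inp_l, eval_or_self, eval_add_ofNat,
      eval_mul_ofNat, hv, -BitVec.ofNat_eq_ofNat]
  refine ⟨?_, ?_, ?_, ?_, ?_, ?_, ?_, ⟨p - e, by omega, ?_, ?_⟩, ?_, ?_⟩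
  · have := (hsh.setMem_right (BitVec.ofNat w j) (BitVec.ofNat w (newText k M o c l j)))
    simp only [Instr.exec, h6', h14']
    exact (this.touch_right (by rwa [hjn])).tick_right
  · simp [letterCode, reg_exec_store, reg_exec_op, reg_exec_input, hr0, -BitVec.ofNat_eq_ofNat]
  · simp [letterCode, reg_exec_store, reg_exec_op, reg_exec_input, hr1, -BitVec.ofNat_eq_ofNat]
  · simp [letterCode, reg_exec_store, reg_exec_op, reg_exec_input, hr2, -BitVec.ofNat_eq_ofNat]
  · simp [letterCode, reg_exec_store, reg_exec_op, reg_exec_input, hr3, -BitVec.ofNat_eq_ofNat]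
  · simp [letterCode, reg_exec_store, reg_exec_op, reg_exec_input, hr5, -BitVec.ofNat_eq_ofNat]
  · rw [reg_exec_store, h6']
  · simp [letterCode, reg_exec_store, reg_exec_op, reg_exec_input, hr6, hp, hpn, h2, h3,
      hI.inp_o, eval_or_self, -BitVec.ofNat_eq_ofNat]
  · intro q hq
    have h0 := hpo q hq
    simp only [he]
    split_ifs with hop
    · rw [he, if_pos hop] at hep
      constructor
      · intro hqp
        have := hI.o_lt q p (by omega) hpk
        omega
      · intro hqj
        have h10 := h0.2 (by omega)
        rcases h10.lt_or_eq with h10 | rfl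
        · omega
        · omega
    · rw [Nat.sub_zero, h0]
      have : o q ≠ j + 1 := fun h => hop (hex.1 ⟨q, hq, h⟩)
      omega
  · simp [letterCode, reg_exec_store, reg_exec_op, reg_exec_input, hr0, hr6, hjn, h1, hI.inp_c,
      eval_or_self, -BitVec.ofNat_eq_ofNat]
  · intro i hji hir
    simp only [Instr.exec, State.tick, State.touch, State.setMem, h6', h14', hmem,
      Function.update_self]
    rcases hji.lt_or_eq with hji | rfl
    · rw [Function.update_of_ne, h.text i hji hir]
      intro hij
      have := congrArg BitVec.toNat hij
      rw [hjn, BitVec.toNat_ofNat, Nat.mod_eq_of_lt (by omega)] at this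
      omega
    · rw [Function.update_self]

/-- Reading each run twice prepares the data for the simulation. -/
theorem exec_prepare (hI : RunInput inp k r σ M o c l) (N : ℕ) :
    ∃ s, Exec inp ω (prepare N) (State.init w) s ∧ Shadows N r (State.init w) s ∧
      Prepared N r (BitVec.ofNat w (σ * M)) (fun j => BitVec.ofNat w (newText k M o c l j)) s ∧
      s.steps ≤ 25 * r + 10 := by
  have h1n : (BitVec.ofNat w 1).toNat = 1 := by
    rw [BitVec.toNat_ofNat, Nat.mod_eq_of_lt (by have := hI.two_lt; omega)]
  have h2n : (BitVec.ofNat w 2).toNat = 2 := by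
    rw [BitVec.toNat_ofNat, Nat.mod_eq_of_lt hI.two_lt]
  set s₁ := (setupCode N).foldl (Instr.exec inp ω) (State.init w) with hs₁
  have hinit : Shadows N r (State.init w) (State.init w) :=
    ⟨fun _ _ => rfl, fun _ _ => rfl, le_self_add, rfl⟩
  have hz : ∀ x, (State.init w).reg x = BitVec.ofNat w 0 := fun _ => rfl
  have hinv₁ : SumInv N r l r s₁ := by
    refine ⟨hinit.foldl_exec (fresh_setupCode N), ?_, ?_, ?_, ?_, ?_, ?_, le_rfl⟩
    all_goals simp [hs₁, setupCode, reg_exec_const, reg_exec_input, hI.inp_r, h1n, hz,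
      -BitVec.ofNat_eq_ofNat]
  obtain ⟨s₂, h₂, hinv₂, hle₂⟩ := exec_countdown (inp := inp) (ω := ω)
    (body := .ofList (sumCode N)) (SumInv N r l) 3 (fun j s h => h.pos)
    (fun j s h => ⟨h.shadows.tick_right, h.one, h.two, h.len, h.sum, h.pos, h.next, h.le⟩)
    hI.r_lt (fun j s hj h => ⟨_, exec_ofList _ _, exec_sumCode hI h,
      (steps_foldl_exec _ _).le⟩) s₁ hinv₁
  set s₃ := (resetCode N).foldl (Instr.exec inp ω) s₂ with hs₃
  have hsum : s₂.reg (N + 5) = BitVec.ofNat w M := by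
    rw [hinv₂.sum, ← Finset.range_eq_Ico, hI.sum_l]
  have h0n : (BitVec.ofNat w 0).toNat = 0 := by simp
  have hinv₃ : LetterInv N k r σ M o c l r s₃ := by
    refine ⟨hinv₂.shadows.foldl_exec (fresh_resetCode N), ?_, ?_, ?_, ?_, ?_, ?_,
      ⟨k, le_rfl, ?_, ?_⟩, ?_, ?_⟩
    case refine_8 =>
      intro q hq
      simp only [hq, true_iff]
      rcases hq.lt_or_eq with hq | rfl
      · rw [← hI.o_k]
        exact (hI.o_lt q k hq le_rfl).le
      · exact hI.o_k.le
    case refine_10 =>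
      intro i h h'
      omega
    all_goals simp [hs₃, resetCode, reg_exec_op, reg_exec_input, hI.inp_r, hI.inp_σ, hI.inp_k,
      h0n, h1n, h2n, hinv₂.one, hinv₂.two, hinv₂.len, hinv₂.next, hsum, hI.c_r, eval_mul_ofNat,
      -BitVec.ofNat_eq_ofNat, -BitVec.toNat_ofNat]
  obtain ⟨s₄, h₄, hinv₄, hle₄⟩ := exec_countdown (inp := inp) (ω := ω)
    (body := .seq (.ofList (letterCode N)) (.instr (.store N (N + 6) (N + 14))))
    (LetterInv N k r σ M o c l) 20 (fun j s h => h.pos)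
    (fun j s h => ⟨h.shadows.tick_right, h.one, h.two, h.len, h.size, h.sum, h.pos, h.str, h.next,
      h.text⟩)
    hI.r_lt (fun j s hj h => ⟨_, .seq (exec_ofList _ _) (.instr _ _), exec_letterCode hI hj h,
      Nat.succ_le_succ (steps_foldl_exec _ _).le⟩) s₃ hinv₃
  refine ⟨s₄, .seq (exec_ofList _ _) (.seq h₂ (.seq (exec_ofList _ _) h₄)), hinv₄.shadows,
    ⟨hinv₄.two, hinv₄.len, hinv₄.size, fun j hj => hinv₄.text j (Nat.zero_le _) hj⟩, ?_⟩
  have e₁ : s₁.steps = 4 := (steps_foldl_exec _ _).trans (Nat.zero_add _)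
  have e₃ : s₃.steps = s₂.steps + 4 := steps_foldl_exec _ _
  omega

end Prepare

end WordRAM

/-! ### Transfer of time and space bounds -/

namespace WordRAM

variable {w : ℕ}

/-- Bounds carry over to a program that follows every halting computation on the same random words.
In expectation this needs no measurability of the running time, since a constant factor and a
constant summand are all that is pulled out of the integral. -/
theorem Prog.Achieves.transfer {A B : Prog} {inp inp' : ℕ → ℕ → BitVec w}
    {good good' : State w → Prop} {r : ℕ} (hrand : A.RandFree → B.RandFree)
    (hsim : ∀ ω s, Exec inp ω A (State.init w) s → ∃ s', Exec inp' ω B (State.init w) s' ∧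
      (good s → good' s') ∧ s'.steps ≤ 3 * s.steps + 35 * r ∧ s'.space ≤ s.space + r)
    {T S : ℝ≥0} {μ : Mode} (h : A.Achieves inp good T S μ) :
    B.Achieves inp' good' (40 * (T + r)) (40 * (S + r)) μ := by
  have hspace : ∀ s s' : State w, s'.space ≤ s.space + r → (s.space : ℝ≥0) ≤ S →
      (s'.space : ℝ≥0) ≤ 40 * (S + r) := by
    intro s s' h h'
    calc (s'.space : ℝ≥0) ≤ s.space + r := by exact_mod_cast h
      _ ≤ 1 * (S + r) := by rw [one_mul]; gcongr
      _ ≤ 40 * (S + r) := by gcongr; norm_num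
  cases μ with
  | deterministic =>
    refine ⟨hrand h.1, fun ω => ?_⟩
    obtain ⟨s, hs, hg, hT, hS⟩ := h.2 ω
    obtain ⟨s', hs', hg', hT', hS'⟩ := hsim ω s hs
    refine ⟨s', hs', hg' hg, ?_, hspace s s' hS' hS⟩
    calc (s'.steps : ℝ≥0) ≤ 3 * s.steps + 35 * r := by exact_mod_cast hT'
      _ ≤ 40 * T + 40 * r := by gcongr <;> norm_num
      _ = 40 * (T + r) := by ring
  | expected =>
    obtain ⟨h₁, h₂⟩ := h
    refine ⟨?_, ?_⟩
    · filter_upwards [h₁] with ω hω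
      obtain ⟨s, hs, hg, hS⟩ := hω
      obtain ⟨s', hs', hg', -, hS'⟩ := hsim ω s hs
      exact ⟨s', hs', hg' hg, hspace s s' hS' hS⟩
    · have hrun : ∀ ω, B.runTime inp' ω ≤ 3 * A.runTime inp ω + 35 * r := by
        intro ω
        unfold Prog.runTime
        rw [ENNReal.mul_iInf_of_ne (by norm_num) (by norm_num), ENNReal.iInf_add]
        refine le_iInf fun s => ?_
        rw [ENNReal.mul_iInf_of_ne (by norm_num) (by norm_num), ENNReal.iInf_add]
        refine le_iInf fun hs => ?_
        obtain ⟨s', hs', -, hT', -⟩ := hsim ω s hs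
        exact (iInf₂_le s' hs').trans (by exact_mod_cast hT')
      have : MeasureTheory.IsProbabilityMeasure (coinMeasure w) := by
        unfold coinMeasure
        infer_instance
      calc ∫⁻ ω, B.runTime inp' ω ∂coinMeasure w
          ≤ ∫⁻ ω, (3 * A.runTime inp ω + 35 * r) ∂coinMeasure w :=
            MeasureTheory.lintegral_mono hrun
        _ = 3 * ∫⁻ ω, A.runTime inp ω ∂coinMeasure w + 35 * r := by
            rw [MeasureTheory.lintegral_add_right _ measurable_const,
              MeasureTheory.lintegral_const_mul' _ _ (by norm_num),
              MeasureTheory.lintegral_const, MeasureTheory.measure_univ, mul_one]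
        _ ≤ 40 * T + 40 * r := by gcongr <;> norm_num
        _ = ((40 * (T + r) : ℝ≥0) : ℝ≥0∞) := by push_cast; ring

end WordRAM

/-! ### The reduction for sets of strings -/

namespace StringSorting

open WordRAM

theorem totalLength_eq_length_flatten {α : Type} {k : ℕ} (P : Fin k → List α) :
    totalLength P = (List.ofFn P).flatten.length := by
  rw [List.length_flatten, List.map_ofFn, List.sum_ofFn]
  rfl

theorem sum_range_getD (l : List ℕ) : ∑ j ∈ Finset.range l.length, l.getD j 0 = l.sum := by
  induction l with
  | nil => rfl
  | cons a l ih =>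
    rw [List.length_cons, Finset.sum_range_succ', List.sum_cons, ← ih, add_comm]
    rfl

theorem getD_offsets {α : Type} {k : ℕ} (P : Fin k → List α) {q : ℕ} (hq : q ≤ k) :
    (offsets P).getD q 0 = ((List.ofFn P).take q).flatten.length := by
  have : q < (offsets P).length := by simp [offsets]; omega
  rw [List.getD_eq_getElem _ _ this]
  exact List.getElem_ofFn _

theorem offsets_congr {α β : Type} {k : ℕ} {P : Fin k → List α} {Q : Fin k → List β}
    (h : ∀ i, (P i).length = (Q i).length) : offsets P = offsets Q := by
  unfold offsets
  congr 1
  funext i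
  have : List.length ∘ P = List.length ∘ Q := funext h
  rw [List.length_flatten, List.length_flatten, List.map_take, List.map_take, List.map_ofFn,
    List.map_ofFn, this]

theorem decode_flatten_rle {k : ℕ} (P : Fin k → List ℕ) :
    decode (List.ofFn fun i => rle (P i)).flatten = (List.ofFn P).flatten := by
  have h : ∀ L : List (List (ℕ × ℕ)), decode L.flatten = (L.map decode).flatten := by
    intro L
    induction L with
    | nil => rfl
    | cons R L ih =>
      rw [List.flatten_cons, List.map_cons, List.flatten_cons, ← ih]
      exact List.flatMap_append
  rw [h, List.map_ofFn]
  congr 2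
  funext i
  exact decode_rle (P i)

variable {k : ℕ} {σ : ℕ} {P : Fin k → List ℕ}

theorem totalRuns_le (P : Fin k → List ℕ) : totalRuns P ≤ totalLength P := by
  unfold totalRuns totalLength
  refine Finset.sum_le_sum fun i _ => ?_
  have := (isReduced_rle (P i)).length_le_length_decode
  rwa [decode_rle] at this

theorem IsStringSet.le_totalRuns (h : IsStringSet σ P) : k ≤ totalRuns P := by
  have : ∑ _i : Fin k, 1 ≤ ∑ i, (rle (P i)).length := by
    refine Finset.sum_le_sum fun i _ => ?_
    exact List.length_pos_iff.2 (rle_ne_nil (h.ne_nil i))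
  simpa [totalRuns, totalLength] using this

theorem IsStringSet.pos_σ (h : IsStringSet σ P) : 0 < σ := by
  obtain ⟨a, ha⟩ := List.exists_mem_of_ne_nil _ (h.ne_nil ⟨0, h.pos⟩)
  exact (Nat.zero_le a).trans_lt (h.lt _ a ha)

/-- The reason why the letters of the two kinds of runs do not interleave. -/
theorem length_add_length_le (P : Fin k → List ℕ) {i j : Fin k} (h : i ≠ j) :
    (P i).length + (P j).length ≤ totalLength P := by
  rw [← Finset.sum_pair (f := fun i => (P i).length) h]
  exact Finset.sum_le_sum_of_subset (Finset.subset_univ _)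

theorem length_le_totalLength (P : Fin k → List ℕ) (i : Fin k) :
    (P i).length ≤ totalLength P :=
  Finset.single_le_sum (f := fun i => (P i).length) (fun _ _ => Nat.zero_le _) (Finset.mem_univ i)

/-- The strings to be sorted instead of `P`. -/
def newStrings (P : Fin k → List ℕ) (i : Fin k) : List ℕ := letters (totalLength P) (rle (P i))

theorem length_newStrings (P : Fin k → List ℕ) (i : Fin k) :
    (newStrings P i).length = (rle (P i)).length := length_letters _ _

theorem totalLength_newStrings (P : Fin k → List ℕ) :
    totalLength (newStrings P) = totalRuns P :=
  Finset.sum_congr rfl fun i _ => length_newStrings P i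

theorem newStrings_lt {i j : Fin k} (h : P i < P j) : newStrings P i < newStrings P j := by
  have hij : i ≠ j := by
    rintro rfl
    exact lt_irrefl _ h
  refine letters_lt_letters (isReduced_rle _) (isReduced_rle _) ?_ ?_
  · rw [decode_rle, decode_rle]
    exact length_add_length_le P hij
  · rwa [decode_rle, decode_rle]

theorem newStrings_lt_iff {i j : Fin k} : newStrings P i < newStrings P j ↔ P i < P j := by
  refine ⟨fun h => ?_, newStrings_lt⟩
  rcases lt_trichotomy (P i) (P j) with h' | h' | h'
  · exact h'
  · rw [newStrings, newStrings, h'] at h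
    exact absurd h (lt_irrefl _)
  · exact absurd (newStrings_lt h') h.not_gt

theorem letters_lt_mul {M : ℕ} {R : List (ℕ × ℕ)} (hR : IsReduced R)
    (hM : (decode R).length ≤ M) (hσ : ∀ a ∈ decode R, a < σ) : ∀ a ∈ letters M R, a < σ * M := by
  induction R with
  | nil => simp [letters]
  | cons p R ih =>
    have hp : p.2 ≤ (decode (p :: R)).length := le_length_decode_of_mem List.mem_cons_self
    intro a ha
    rcases List.mem_cons.1 ha with rfl | ha
    · refine (runLetter_mem _ hR.1 (hp.trans hM)).2.trans_le (Nat.mul_le_mul_right _ ?_)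
      refine hσ p.1 ?_
      rw [decode_cons]
      exact List.mem_append_left _ (List.mem_replicate.2 ⟨hR.1.ne', rfl⟩)
    · refine ih hR.2.2 ?_ ?_ a ha
      · rw [decode_cons, List.length_append] at hM
        omega
      · intro b hb
        refine hσ b ?_
        rw [decode_cons]
        exact List.mem_append_right _ hb

theorem isStringSet_newStrings (h : IsStringSet σ P) :
    IsStringSet (σ * totalLength P) (newStrings P) := by
  refine ⟨h.pos, fun i j hij => ?_, fun i => ?_, fun i => ?_⟩
  · apply h.injective
    rcases lt_trichotomy (P i) (P j) with h' | h' | h'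
    · exact absurd (newStrings_lt h') (by rw [hij]; exact lt_irrefl _)
    · exact h'
    · exact absurd (newStrings_lt h') (by rw [hij]; exact lt_irrefl _)
  · rw [← List.length_pos_iff, length_newStrings, List.length_pos_iff]
    exact rle_ne_nil (h.ne_nil i)
  · refine letters_lt_mul (isReduced_rle _) ?_ ?_
    · rw [decode_rle]
      exact length_le_totalLength P i
    · rw [decode_rle]
      exact h.lt i

theorem IsStringSet.runInput (h : IsStringSet σ P) {w : ℕ} (hM : totalLength P < 2 ^ w)
    (hσ : σ ≤ 2 ^ w) (hw : 2 < 2 ^ w) :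
    RunInput (rleInput w σ P) k (totalRuns P) σ (totalLength P)
      (fun q => (offsets fun i => rle (P i)).getD q 0)
      (fun j => ((List.ofFn fun i => rle (P i)).flatten.map Prod.fst).getD j 0)
      (fun j => ((List.ofFn fun i => rle (P i)).flatten.map Prod.snd).getD j 0) := by
  have hlen : (List.ofFn fun i => rle (P i)).flatten.length = totalRuns P :=
    (totalLength_eq_length_flatten _).symm
  have hmem : ∀ p ∈ (List.ofFn fun i => rle (P i)).flatten, ∃ i, p ∈ rle (P i) := by
    intro p hp
    obtain ⟨R, hR, hp⟩ := List.mem_flatten.1 hp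
    obtain ⟨i, rfl⟩ := (List.mem_ofFn' _ _).1 hR
    exact ⟨i, hp⟩
  have hget : ∀ j < totalRuns P, ∃ p, (∃ i, p ∈ rle (P i)) ∧
      ((List.ofFn fun i => rle (P i)).flatten.map Prod.fst).getD j 0 = p.1 ∧
      ((List.ofFn fun i => rle (P i)).flatten.map Prod.snd).getD j 0 = p.2 := by
    intro j hj
    rw [← hlen] at hj
    refine ⟨_, hmem _ (List.getElem_mem hj), ?_, ?_⟩ <;>
      rw [List.getD_eq_getElem _ _ (by rwa [List.length_map]), List.getElem_map]
  have hpos : ∀ i, ∀ p ∈ rle (P i), 0 < p.2 := fun i p hp => (isReduced_rle (P i)).pos_of_mem hp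
  refine ⟨rfl, rfl, rfl, fun _ => rfl, fun _ => rfl, fun _ => rfl, hw, ?_, ?_, hM, ?_, ?_, ?_, ?_,
    ?_, ?_, ?_, ?_⟩
  · exact (h.le_totalRuns.trans (totalRuns_le P)).trans_lt hM
  · exact (totalRuns_le P).trans_lt hM
  · intro j
    rcases lt_or_ge j (totalRuns P) with hj | hj
    · obtain ⟨p, ⟨i, hp⟩, h₁, -⟩ := hget j hj
      simp only [h₁]
      refine (h.lt i _ ?_).trans_le hσ
      rw [← decode_rle (P i)]
      exact List.mem_flatMap.2 ⟨p, hp, List.mem_replicate.2 ⟨(hpos i p hp).ne', rfl⟩⟩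
    · rw [List.getD_eq_default _ _ (by rw [List.length_map, hlen]; exact hj)]
      exact Nat.two_pow_pos w
  · exact List.getD_eq_default _ _ (by rw [List.length_map, hlen])
  · intro j hj
    obtain ⟨p, ⟨i, hp⟩, -, h₂⟩ := hget j hj
    simp only [h₂]
    exact hpos i p hp
  · intro j hj
    obtain ⟨p, ⟨i, hp⟩, -, h₂⟩ := hget j hj
    simp only [h₂]
    have := le_length_decode_of_mem hp
    rw [decode_rle] at this
    exact this.trans (length_le_totalLength P i)
  · have := sum_range_getD ((List.ofFn fun i => rle (P i)).flatten.map Prod.snd)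
    rwa [List.length_map, hlen, sum_snd_eq_length_decode, decode_flatten_rle,
      ← totalLength_eq_length_flatten] at this
  · rw [getD_offsets _ (Nat.zero_le _)]
    rfl
  · rw [getD_offsets _ le_rfl, List.take_of_length_le (by simp), hlen]
  · intro p q hpq hq
    rw [getD_offsets _ (hpq.le.trans hq), getD_offsets _ hq]
    refine length_flatten_take_lt _ ?_ hpq (by simpa using hq)
    intro R hR
    obtain ⟨i, rfl⟩ := (List.mem_ofFn' _ _).1 hR
    exact rle_ne_nil (h.ne_nil i)

theorem IsStringSet.inputMatches (h : IsStringSet σ P) (w : ℕ) :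
    InputMatches (totalRuns P) (BitVec.ofNat w (σ * totalLength P))
      (fun j => BitVec.ofNat w (newText k (totalLength P)
        (fun q => (offsets fun i => rle (P i)).getD q 0)
        (fun j => ((List.ofFn fun i => rle (P i)).flatten.map Prod.fst).getD j 0)
        (fun j => ((List.ofFn fun i => rle (P i)).flatten.map Prod.snd).getD j 0) j))
      (plainInput w (σ * totalLength P) (newStrings P)) (rleInput w σ P) := by
  have hlen : (List.ofFn fun i => rle (P i)).flatten.length = totalRuns P :=
    (totalLength_eq_length_flatten _).symm
  have hflat : (List.ofFn (newStrings P)).flatten =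
      ((List.ofFn fun i => rle (P i)).map (letters (totalLength P))).flatten := by
    rw [List.map_ofFn]
    rfl
  refine ⟨fun j => ?_, fun j => ?_, fun j => ?_, fun a j => ?_⟩
  · match j with
    | 0 => rfl
    | 1 => simp [plainInput, rleInput, inputOf, totalLength_newStrings]
    | 2 => rfl
    | j + 3 => rfl
  · change BitVec.ofNat w ((offsets (newStrings P)).getD j 0) = _
    rw [offsets_congr (length_newStrings P)]
    rfl
  · change BitVec.ofNat w ((List.ofFn (newStrings P)).flatten.getD j 0) = _
    split_ifs with hj
    · rw [hflat, getD_flatten_letters _ _ _ (by rwa [hlen])]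
      · unfold newText
        have : (∃ q ≤ (List.ofFn fun i => rle (P i)).length,
            ((List.ofFn fun i => rle (P i)).take q).flatten.length = j + 1) ↔
            ∃ q ≤ k, (offsets fun i => rle (P i)).getD q 0 = j + 1 := by
          rw [List.length_ofFn]
          refine exists_congr fun q => and_congr_right fun hq => ?_
          rw [getD_offsets _ hq]
        simp only [this]
      · intro R hR
        obtain ⟨i, rfl⟩ := (List.mem_ofFn' _ _).1 hR
        exact rle_ne_nil (h.ne_nil i)
    · rw [List.getD_eq_default]
      · rfl
      · rw [← totalLength_eq_length_flatten, totalLength_newStrings]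
        omega
  · rfl

theorem SortedOutput.of_newStrings {N r w : ℕ} (hN : 0 < N) {s t : State w}
    (hst : Shadows N r s t) (h : SortedOutput (newStrings P) s) : SortedOutput P t := by
  obtain ⟨π, hπ, hout⟩ := h
  refine ⟨π, fun i j hij => newStrings_lt_iff.1 (hπ hij), fun j => ?_⟩
  rw [hst.mem 0 hN]
  exact hout j

/-- Words of logarithmic length for the run-length encoded strings are long enough for the plain
strings and for all intermediate results, since `r + σ M < (M + σ + 1) ^ 2`. -/
theorem word_bounds {a w M σ r : ℕ} (hM : 0 < M) (hσ : 0 < σ) (hr : r ≤ M)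
    (hw : (2 * a + 2) * Nat.clog 2 (M + σ + 1) ≤ w) :
    a * Nat.clog 2 (r + σ * M + 1) ≤ w ∧ M < 2 ^ w ∧ σ ≤ 2 ^ w ∧ 2 < 2 ^ w := by
  have h1 : M + σ + 1 ≤ 2 ^ Nat.clog 2 (M + σ + 1) := Nat.le_pow_clog one_lt_two _
  have h2 : Nat.clog 2 (r + σ * M + 1) ≤ 2 * Nat.clog 2 (M + σ + 1) := by
    refine Nat.clog_le_of_le_pow ?_
    calc r + σ * M + 1 ≤ (M + σ + 1) ^ 2 := by nlinarith
      _ ≤ (2 ^ Nat.clog 2 (M + σ + 1)) ^ 2 := Nat.pow_le_pow_left h1 2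
      _ = 2 ^ (2 * Nat.clog 2 (M + σ + 1)) := by rw [← pow_mul, mul_comm]
  have h3 : M + σ + 1 ≤ 2 ^ w := by
    refine h1.trans (Nat.pow_le_pow_right two_pos ?_)
    nlinarith
  refine ⟨?_, by omega, by omega, by omega⟩
  nlinarith [Nat.mul_le_mul_left a h2]

end StringSorting

theorem mainTheorem6 :
    ∃ C : ℝ≥0, ∀ (μ : WordRAM.Mode) (t s : ℕ → ℕ → ℕ → ℝ≥0) (A : WordRAM.Prog),
      StringSorting.SortsStrings μ A t s →
      ∃ B : WordRAM.Prog, StringSorting.SortsRLEStrings μ B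
        (fun k m r σ => C * (t k r (σ * m) + r))
        (fun k m r σ => C * (s k r (σ * m) + r)) := by
  refine ⟨40, fun μ t s A hA => ?_⟩
  obtain ⟨c, hA⟩ := hA
  obtain ⟨N₀, hN₀⟩ := A.exists_below
  -- The array `0` holds the output and must not be used for the text.
  set N := N₀ + 1 with hN
  have hAN : A.Below N := hN₀.mono (Nat.le_succ _)
  refine ⟨.seq (WordRAM.prepare N) (A.simulate N), 2 * c + 2, fun w k σ P hP hw => ?_⟩
  have hr : 0 < StringSorting.totalRuns P := hP.pos.trans_le hP.le_totalRuns
  have hrM := StringSorting.totalRuns_le P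
  obtain ⟨hc, hM2, hσ2, hw2⟩ := StringSorting.word_bounds (hr.trans_le hrM) hP.pos_σ hrM hw
  have hQ := hA w k _ _ (StringSorting.isStringSet_newStrings hP)
    (by rwa [StringSorting.totalLength_newStrings])
  rw [StringSorting.totalLength_newStrings] at hQ
  refine WordRAM.Prog.Achieves.transfer (B := .seq (WordRAM.prepare N) (A.simulate N))
    (fun h => ⟨WordRAM.randFree_prepare N, h.simulate⟩) (fun ω u hu => ?_) hQ
  obtain ⟨v, hv, hsh, hprep, hsteps⟩ :=
    WordRAM.exec_prepare (ω := ω) (hP.runInput hM2 hσ2 hw2) N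
  obtain ⟨v', hv', hsh', -, hsteps'⟩ :=
    hu.simulate (hP.inputMatches w) hw2 (hrM.trans_lt hM2) hAN hsh hprep
  refine ⟨v', .seq hv hv', .of_newStrings (Nat.succ_pos _) hsh', ?_, hsh'.space_le⟩
  have h0 : (WordRAM.State.init w).steps = 0 := rfl
  omega
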